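/- A permutation is a finite list of distinct real numbers. Two lists $p_1\ldots p_n$ and $q_1\ldots q_n$ are order isomorphic if, for all $i<j$, $p_i<p_j$ if and only if $q_i<q_j$. A permutation contains a pattern (a permutation) $q$ if some subsequence of it is order isomorphic to $q$, and avoids $q$ otherwise. A *codeword* is a word over $\{l,r,m,f,t\}$ such that (i) the number of letters $t$ immediately preceding any letter $x\in\{l,r,m,f\}$ is at most the number of $m$'s minus the number of $f$'s to the left of $x$; (ii) the word ends with $f$; (iii) the total number of $f$'s is one more than the total number of $m$'s. It represents the permutation built as follows. Start with a single open slot $\diamond$ and $i=1$. For each letter $x\in\{l,r,m,f\}$ in turn, let $j$ be the number of $t$'s immediately preceding $x$; replace the $(j+1)$-st open slot from the left by $i\,\diamond$ if $x=l$, by $\diamond\, i$ if $x=r$, by $\diamond\, i\,\diamond$ if $x=m$, by $i$ if $x=f$; then increase $i$ by $1$. (By (iii) no open slot is left at the end.) Let $E(q)$ be the set of codewords whose permutation avoids $q$. **Theorem.** For every pattern $q$: 1. $E(q)$ is accepted by a linear-bounded automaton in polynomial time: there are a nondeterministic one-tape Turing machine $M$ with finitely many states and tape symbols, and a polynomial $p$,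 such that on every input $w\in\{l,r,m,f,t\}^*$ every computation of $M$ uses only the $|w|$ cells that hold the input and the next cell to their right, and has at most $p(|w|)$ steps, and $M$ has a computation on $w$ that enters an accepting state if and only if $w\in E(q)$. 2. Hence $E(q)$ is a context-sensitive language: it is generated by a grammar with finitely many nonterminals and finitely many productions $\alpha\to\beta$, where $\alpha$ contains a nonterminal and $|\alpha|\le|\beta|$ (with the usual exception that $S\to\varepsilon$ is allowed if the start symbol $S$ occurs on no right-hand side). -/

import Mathlib

/-! ### Permutations as lists of distinct numbers, and pattern containment -/

namespace PatternPerm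

/-- Two finite lists are order isomorphic if they have the same length and their entries at any
two positions `i < j` compare in the same way. -/
def OrderIsomorphic {α β : Type*} [LT α] [LT β] (p : List α) (q : List β) : Prop :=
  ∃ h : p.length = q.length, ∀ (i j : ℕ) (hij : i < j) (hj : j < p.length),
    (p[i]'(hij.trans hj) < p[j] ↔ q[i]'(h ▸ hij.trans hj) < q[j]'(h ▸ hj))

/-- `p` contains the pattern `q` if some (not necessarily contiguous) subsequence of `p` is
order isomorphic to `q`. -/
def Contains {α β : Type*} [LT α] [LT β] (p : List α) (q : List β) : Prop :=
  ∃ s : List α, s.Sublist p ∧ OrderIsomorphic s q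

/-- `p` avoids `q` if it does not contain it. -/
def Avoids {α β : Type*} [LT α] [LT β] (p : List α) (q : List β) : Prop :=
  ¬ Contains p q

end PatternPerm

/-! ### The insert-and-translate encoding -/

namespace ItEncoding

/-- The five letters: insert on the left, on the right, in the middle of a slot, fill a slot,
and translate (move one slot to the right). -/
inductive Letter where
  | l | r | m | f | t
  deriving DecidableEq

/-- Legal codewords. Every letter `x ≠ t` is immediately preceded by at most `#m - #f` letters
`t`, where `#m` and `#f` count the letters `m` and `f` to the left of `x` (the inequality is
written without subtraction, and so says in particular `#f ≤ #m`); the word ends with `f`; and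
no slot remains open: there is one slot at the start, each `m` adds one and each `f` removes
one. -/
def IsCodeword (w : List Letter) : Prop :=
  (∀ (u v : List Letter) (x : Letter), w = u ++ x :: v → x ≠ Letter.t →
      (u.rtakeWhile (fun y => decide (y = Letter.t))).length + u.count Letter.f
        ≤ u.count Letter.m) ∧
  w.getLast? = some Letter.f ∧
  w.count Letter.f = w.count Letter.m + 1

/-- A partly built permutation is a list in which `none` is an open slot and `some i` is the
entry `i`. `replaceSlot s b p` replaces the open slot of `p` that has exactly `s` open slots to
its left by the block `b` (and leaves `p` unchanged if there is no such slot). -/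
def replaceSlot : ℕ → List (Option ℕ) → List (Option ℕ) → List (Option ℕ)
  | _, _, [] => []
  | s, b, some a :: p => some a :: replaceSlot s b p
  | 0, b, none :: p => b ++ p
  | s + 1, b, none :: p => none :: replaceSlot s b p

/-- The state of the insertion procedure: the partly built permutation, the next entry to be
inserted, and the number of open slots to the left of the next slot. -/
structure BuildState where
  perm : List (Option ℕ)
  next : ℕ
  slot : ℕ

/-- Read one letter. -/
def BuildState.read (σ : BuildState) : Letter → BuildState
  | Letter.t => ⟨σ.perm, σ.next, σ.slot + 1⟩
  | Letter.l => ⟨replaceSlot σ.slot [some σ.next, none] σ.perm, σ.next + 1, 0⟩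
  | Letter.r => ⟨replaceSlot σ.slot [none, some σ.next] σ.perm, σ.next + 1, 0⟩
  | Letter.m => ⟨replaceSlot σ.slot [none, some σ.next, none] σ.perm, σ.next + 1, 0⟩
  | Letter.f => ⟨replaceSlot σ.slot [some σ.next] σ.perm, σ.next + 1, 0⟩

/-- The permutation represented by a word: start from a single open slot with next entry `1`,
read all letters, and list the entries from left to right. (At the end of a legal codeword
no slot is open, so that `reduceOption` only strips the `some`s.) -/
def decode (w : List Letter) : List ℕ :=
  (w.foldl BuildState.read ⟨[none], 1, 0⟩).perm.reduceOption

/-- The language of the legal codewords whose permutation avoids `q`. -/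
def avoidingCodewords (q : List ℝ) : Language Letter :=
  {w | IsCodeword w ∧ PatternPerm.Avoids (decode w) q}

end ItEncoding

/-! ### Nondeterministic Turing machines and linear-bounded automata -/

namespace NTuring

/-- Head moves. -/
inductive Move where
  | left | right | stay

/-- The new head position; the tape is infinite to the right only, and a move to the left from
cell `0` leaves the head there. -/
def Move.apply : Move → ℕ → ℕ
  | Move.left, i => i - 1
  | Move.right, i => i + 1
  | Move.stay, i => i

/-- A nondeterministic one-tape Turing machine with input alphabet `α`: finitely many states and
tape symbols, the input letters being tape symbols other than the blank. `trans s a` is the set of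
possible actions (new state, symbol written, head move) in state `s` with scanned symbol `a`;
the machine halts if there is none. -/
structure Machine (α : Type) where
  State : Type
  TapeSymbol : Type
  finite_state : Finite State
  finite_tapeSymbol : Finite TapeSymbol
  embed : α → TapeSymbol
  embed_injective : Function.Injective embed
  blank : TapeSymbol
  embed_ne_blank : ∀ a, embed a ≠ blank
  start : State
  accept : Set State
  trans : State → TapeSymbol → Set (State × TapeSymbol × Move)

namespace Machine

variable {α : Type} (M : Machine α)

/-- A configuration: state, head position, tape contents. -/
structure Cfg where
  state : M.State
  head : ℕ
  tape : ℕ → M.TapeSymbol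

/-- The initial configuration on input `w`: the input stands in the cells `0, …, |w| - 1`, all
other cells are blank, and the head is on cell `0`. -/
def init (w : List α) : M.Cfg where
  state := M.start
  head := 0
  tape := fun i => (w.map M.embed).getD i M.blank

/-- One step of computation. -/
def Step (c c' : M.Cfg) : Prop :=
  ∃ (s : M.State) (a : M.TapeSymbol) (d : Move), (s, a, d) ∈ M.trans c.state (c.tape c.head) ∧
    c' = ⟨s, d.apply c.head, Function.update c.tape c.head a⟩

/-- `M.Steps n c c'`: some computation of exactly `n` steps leads from `c` to `c'`. -/
inductive Steps : ℕ → M.Cfg → M.Cfg → Prop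
  | refl (c : M.Cfg) : Steps 0 c c
  | tail {n : ℕ} {c c' c'' : M.Cfg} : Steps n c c' → M.Step c' c'' → Steps (n + 1) c c''

/-- The accepted language: the words on which some computation enters an accepting state. -/
def language : Language α :=
  {w | ∃ (n : ℕ) (c : M.Cfg), M.Steps n (M.init w) c ∧ c.state ∈ M.accept}

/-- Linear-bounded automata: on every input `w`, the head never leaves the first `|w| + 1` cells
of the tape. So at no time does the tape contain more than `|w| + 1` (non-blank) symbols. -/
def IsLinearBounded : Prop :=
  ∀ (w : List α) (n : ℕ) (c : M.Cfg), M.Steps n (M.init w) c → c.head < w.length + 1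

/-- Every computation on an input `w`, accepting or not, has at most `p(|w|)` steps, for a fixed
polynomial `p`. -/
def RunsInPolynomialTime : Prop :=
  ∃ p : Polynomial ℕ, ∀ (w : List α) (n : ℕ) (c : M.Cfg),
    M.Steps n (M.init w) c → n ≤ p.eval w.length

end Machine

end NTuring

/-! ### Context-sensitive grammars -/

/-- Grammars with terminals `T`: finitely many nonterminals, a start symbol, and finitely many
productions `(a, b)`, read `a → b`, such that `a` contains a nonterminal. -/
structure PhraseGrammar (T : Type) where
  NT : Type
  finite_NT : Finite NT
  start : NT
  rules : Set (List (Symbol T NT) × List (Symbol T NT))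
  finite_rules : rules.Finite
  exists_nonterminal : ∀ ρ ∈ rules, ∃ A : NT, Symbol.nonterminal A ∈ ρ.1

namespace PhraseGrammar

variable {T : Type} (G : PhraseGrammar T)

/-- One application of a production inside a word. -/
def Produces (x y : List (Symbol T G.NT)) : Prop :=
  ∃ ρ ∈ G.rules, ∃ u v : List (Symbol T G.NT), x = u ++ ρ.1 ++ v ∧ y = u ++ ρ.2 ++ v

/-- The words over the terminals that can be derived from the start symbol. -/
def language : Language T :=
  {w | Relation.ReflTransGen G.Produces [Symbol.nonterminal G.start] (w.map Symbol.terminal)}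

/-- A grammar is context-sensitive if no production is contracting, with the usual exception
that `S → ε` is allowed if the start symbol `S` occurs on no right-hand side. -/
def IsContextSensitive : Prop :=
  ∀ ρ ∈ G.rules, ρ.1.length ≤ ρ.2.length ∨
    (ρ = ([Symbol.nonterminal G.start], []) ∧
      ∀ ρ' ∈ G.rules, Symbol.nonterminal G.start ∉ ρ'.2)

end PhraseGrammar

/-- A language is context-sensitive if it is generated by a context-sensitive grammar. -/
def IsContextSensitiveLanguage {T : Type} (L : Language T) : Prop :=
  ∃ G : PhraseGrammar T, G.IsContextSensitive ∧ G.language = L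

/-! Fix a pattern `q` of length `k` and a word of length `n`. Entries are numbered in the order of
insertion, so two entries compare in value like the positions of their letters in the word. Their
left-to-right order is settled when the later one is inserted: if the earlier entry has `c` open
slots to its left and the new letter is preceded by `j` letters `t`, the new entry goes to its right
exactly when `c ≤ j` (`Legal.slotsBefore_old`). Otherwise it goes to its left, and `c` grows by one
for `m`, drops by one for `f` and stays for `l` and `r`. So one scan of the word with a fixed number
of counters checks whether `k` given positions carry a copy of `q` (`step_scan`, `step_end`,
`Legal.contains_iff`). Trying all `(n + 1) ^ k` tuples of positions takes polynomially many counter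
steps (`exists_haltsIn_automaton`).

The counters never exceed `n` and are only compared, copied, incremented or reset. Each is therefore
a mark on one tape cell, and one sweep over the tape performs one step (`haltsIn_device`). A sweep
costs `2 * n + 2` moves of a Turing machine that never goes beyond cell `n` (`steps_sweep`,
`machine_isLinearBounded`). The machine is deterministic, so its halting computation bounds the
length of all others and decides acceptance.

For the grammar, every input letter becomes one nonterminal that also records the tape symbol and
possibly the head; the extra cell is stored in the last nonterminal. A machine step then rewrites
one symbol into one or two into two, so nothing contracts. The invariant `Sentential` gives
soundness, `language_le_grammar` completeness. The empty word is not a codeword, so no production `S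
→ ε` is needed. -/

/-! ### Deterministic iteration -/

/-- Iterating `f` from `c` stops after exactly `N` applications with the verdict `r`. -/
inductive HaltsIn {C : Type*} (f : C → Bool ⊕ C) : ℕ → C → Bool → Prop
  | halt {c : C} {r : Bool} : f c = Sum.inl r → HaltsIn f 1 c r
  | step {N : ℕ} {c c' : C} {r : Bool} : f c = Sum.inr c' → HaltsIn f N c' r →
      HaltsIn f (N + 1) c r

/-- The simulation is in lockstep, so the step count and hence a time bound carry over unchanged. -/
theorem HaltsIn.simulate {C D : Type*} {f : C → Bool ⊕ C} {g : D → Bool ⊕ D} (R : C → D → Prop)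
    (hl : ∀ c d r, R c d → f c = Sum.inl r → g d = Sum.inl r)
    (hr : ∀ c d c', R c d → f c = Sum.inr c' → ∃ d', g d = Sum.inr d' ∧ R c' d')
    {N : ℕ} {c : C} {r : Bool} (h : HaltsIn f N c r) : ∀ {d : D}, R c d → HaltsIn g N d r := by
  induction h with
  | halt hc => exact fun hR => .halt (hl _ _ _ hR hc)
  | step hc _ ih =>
    intro d hR
    obtain ⟨d', hd, hR'⟩ := hr _ _ _ hR hc
    exact .step hd (ih hR')

/-! ### Computations of deterministic machines -/

namespace NTuring.Machine

variable {α : Type} {M : Machine α}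

theorem Steps.trans {n m : ℕ} {a b c : M.Cfg} (h : M.Steps n a b) (h' : M.Steps m b c) :
    M.Steps (n + m) a c := by
  induction h' with
  | refl => exact h
  | tail _ hs ih => exact (ih h).tail hs

theorem Steps.single {a b : M.Cfg} (h : M.Step a b) : M.Steps 1 a b :=
  (Steps.refl a).tail h

theorem Steps.eq_of_halted {n : ℕ} {a b : M.Cfg} (h : M.Steps n a b) (ha : ∀ c, ¬ M.Step a c) :
    n = 0 ∧ b = a := by
  induction h with
  | refl => exact ⟨rfl, rfl⟩
  | tail _ hs ih =>
    obtain ⟨-, rfl⟩ := ih ha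
    exact absurd hs (ha _)

theorem Step.unique (hM : ∀ s a, (M.trans s a).Subsingleton) {a b c : M.Cfg} (h : M.Step a b)
    (h' : M.Step a c) : b = c := by
  obtain ⟨s, x, d, ht, rfl⟩ := h
  obtain ⟨s', x', d', ht', rfl⟩ := h'
  have := hM _ _ ht ht'
  simp only [Prod.mk.injEq] at this
  obtain ⟨rfl, rfl, rfl⟩ := this
  rfl

theorem Steps.head {n : ℕ} {a c : M.Cfg} (h : M.Steps (n + 1) a c) :
    ∃ b, M.Step a b ∧ M.Steps n b c := by
  induction n generalizing c with
  | zero =>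
    cases h with
    | tail h hs => cases h; exact ⟨_, hs, .refl _⟩
  | succ n ih =>
    cases h with
    | tail h hs =>
      obtain ⟨b, hb, hb'⟩ := ih h
      exact ⟨b, hb, hb'.tail hs⟩

/-- By determinism the shorter of two computations is an initial part of the longer one. -/
theorem Steps.comparable (hM : ∀ s a, (M.trans s a).Subsingleton) {n m : ℕ} {a b c : M.Cfg}
    (h : M.Steps n a b) (h' : M.Steps (n + m) a c) : M.Steps m b c := by
  induction n generalizing a with
  | zero => cases h; simpa using h'
  | succ n ih =>
    obtain ⟨a₁, h₁, h₂⟩ := h.head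
    rw [show n + 1 + m = n + m + 1 by omega] at h'
    obtain ⟨a₂, h₃, h₄⟩ := h'.head
    obtain rfl := h₁.unique hM h₃
    exact ih h₂ h₄

theorem Steps.le_of_halted (hM : ∀ s a, (M.trans s a).Subsingleton) {n m : ℕ} {a b c : M.Cfg}
    (h : M.Steps n a b) (h' : M.Steps m a c) (hc : ∀ d, ¬ M.Step c d) : n ≤ m := by
  by_contra! hlt
  obtain ⟨d, rfl⟩ := Nat.exists_eq_add_of_lt hlt
  have := (Steps.comparable hM h' (m := d + 1) (by simpa [add_assoc] using h)).eq_of_halted hc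
  omega

theorem Steps.eq_of_halted_of_halted (hM : ∀ s a, (M.trans s a).Subsingleton) {n m : ℕ}
    {a b c : M.Cfg} (h : M.Steps n a b) (h' : M.Steps m a c) (hb : ∀ d, ¬ M.Step b d)
    (hc : ∀ d, ¬ M.Step c d) : b = c := by
  obtain rfl : n = m := le_antisymm (h.le_of_halted hM h' hc) (h'.le_of_halted hM h hb)
  exact ((h.comparable hM (m := 0) h').eq_of_halted hb).2.symm

end NTuring.Machine

/-! ### Sweeping devices -/

/-- A deterministic device with a finite control that repeatedly sweeps from left to right over
the letters of the input, followed by an end marker (the letter `none`); every cell also carries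
a symbol that the device may change. At the end of a sweep it may halt with a verdict. -/
structure SweepDevice (α : Type) where
  State : Type
  Mark : Type
  finite_state : Finite State
  finite_mark : Finite Mark
  start : State
  blank : Mark
  next : State → Option α → Mark → State × Mark
  verdict : State → Option Bool

namespace SweepDevice

open NTuring

variable {α : Type} (D : SweepDevice α)

/-- The state after the first `i` cells of a sweep. -/
def stateAt (w : List α) (σ : D.State) (τ : ℕ → D.Mark) : ℕ → D.State
  | 0 => σ
  | i + 1 => (D.next (stateAt w σ τ i) w[i]? (τ i)).1

/-- The symbol that a sweep writes into cell `i`. -/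
def markAt (w : List α) (σ : D.State) (τ : ℕ → D.Mark) (i : ℕ) : D.Mark :=
  (D.next (D.stateAt w σ τ i) w[i]? (τ i)).2

/-- A full sweep. -/
def sweep (w : List α) (c : D.State × (ℕ → D.Mark)) : Bool ⊕ (D.State × (ℕ → D.Mark)) :=
  match D.verdict (D.stateAt w c.1 c.2 (w.length + 1)) with
  | some r => Sum.inl r
  | none => Sum.inr (D.stateAt w c.1 c.2 (w.length + 1), D.markAt w c.1 c.2)

/-- Control states of the Turing machine of a sweeping device: sweeping to the right (the flag
tells whether the head is on cell `0`), returning to cell `0`, and halted. -/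
inductive Control (S : Type) where
  | right (first : Bool) (s : S)
  | left (s : S)
  | halt (r : Bool)

instance {S : Type} [Finite S] : Finite (Control S) :=
  Finite.of_surjective
    (fun x : (Bool × S) ⊕ S ⊕ Bool => match x with
      | .inl (b, s) => Control.right b s
      | .inr (.inl s) => Control.left s
      | .inr (.inr r) => Control.halt r)
    (fun c => match c with
      | .right b s => ⟨.inl (b, s), rfl⟩
      | .left s => ⟨.inr (.inl s), rfl⟩
      | .halt r => ⟨.inr (.inr r), rfl⟩)

/-- Tape symbols: the letter (`none` for the end marker) and, in cells that have been visited, a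
flag for cell `0` and the symbol of the device. -/
abbrev Cell : Type := Option α × Option (Bool × D.Mark)

/-- The symbol of the device in a cell. -/
def content (x : D.Cell) : D.Mark :=
  (x.2.map Prod.snd).getD D.blank

/-- The transition function of the Turing machine. -/
def action : Control D.State → D.Cell → Option (Control D.State × D.Cell × Move)
  -- The first blank cell has the letter `none` and so serves as the end marker; the head turns
  -- around there.
  | .right b s, x =>
    some (if x.1.isSome then .right false (D.next s x.1 (D.content x)).1
        else .left (D.next s x.1 (D.content x)).1,
      (x.1, some (b, (D.next s x.1 (D.content x)).2)),
      if x.1.isSome then .right else .stay)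
  -- A returning head meets only cells that the sweep has just rewritten, so this case does not
  -- arise in a run.
  | .left _, (_, none) => none
  | .left s, (x, some (false, m)) => some (.left s, (x, some (false, m)), .left)
  | .left s, (x, some (true, m)) =>
    some ((D.verdict s).elim (.right true s) .halt, (x, some (true, m)), .stay)
  | .halt _, _ => none

/-- The Turing machine of a sweeping device. -/
def machine [Finite α] : Machine α where
  State := Control D.State
  TapeSymbol := D.Cell
  finite_state := by have := D.finite_state; infer_instance
  finite_tapeSymbol := by have := D.finite_mark; infer_instance
  embed a := (some a, none)
  embed_injective a b h := by simpa using h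
  blank := (none, none)
  embed_ne_blank a h := by simp at h
  start := .right true D.start
  accept := {.halt true}
  trans s x := {y | D.action s x = some y}

variable [Finite α]

theorem machine_subsingleton (s : D.machine.State) (x : D.machine.TapeSymbol) :
    (D.machine.trans s x).Subsingleton := by
  intro y hy z hz
  have hy : D.action s x = some y := hy
  have hz : D.action s x = some z := hz
  exact Option.some.inj (hy.symm.trans hz)

theorem machine_step {s s' : Control D.State} {i i' : ℕ} {T T' : ℕ → D.Cell} {x : D.Cell}
    {d : Move} (h : D.action s (T i) = some (s', x, d)) (hi : d.apply i = i') (hx : T' i = x)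
    (hT : ∀ j ≠ i, T' j = T j) :
    D.machine.Step ⟨s, i, T⟩ ⟨s', i', T'⟩ := by
  refine ⟨s', x, d, h, ?_⟩
  obtain rfl : T' = Function.update T i x := Function.eq_update_iff.2 ⟨hx, hT⟩
  subst hi
  rfl

theorem machine_halted (r : Bool) (i : ℕ) (T : ℕ → D.Cell) (c : D.machine.Cfg) :
    ¬ D.machine.Step ⟨.halt r, i, T⟩ c := by
  rintro ⟨s, x, d, h, -⟩
  have h : D.action (.halt r) (T i) = some (s, x, d) := h
  simp [action] at h

/-- The letter component of a cell never changes, and the head moves right only from a cell that has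
a letter, that is, from a cell before `|w|`. -/
theorem machine_isLinearBounded : D.machine.IsLinearBounded := by
  intro w n c h
  suffices H : (∀ i, (c.tape i : D.Cell).1 = w[i]?) ∧ c.head ≤ w.length from Nat.lt_succ_of_le H.2
  generalize hc₀ : D.machine.init w = c₀ at h
  induction h with
  | refl =>
    subst hc₀
    refine ⟨fun i => ?_, Nat.zero_le _⟩
    simp only [Machine.init, machine, List.getD_eq_getElem?_getD, List.getElem?_map]
    cases w[i]? <;> rfl
  | @tail n c₀ c c' _ hs ih =>
    obtain ⟨hT, hh⟩ := ih hc₀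
    obtain ⟨s, x, d, ht, rfl⟩ := hs
    have ht : D.action c.state (c.tape c.head) = some (s, x, d) := ht
    have key : (x : D.Cell).1 = w[c.head]? ∧ d.apply c.head ≤ w.length := by
      rw [← hT]
      have hx := hT c.head
      generalize (c.tape c.head : D.Cell) = y at ht hx
      generalize c.state = s₀ at ht
      obtain ⟨y, m⟩ := y
      cases s₀ with
      | right b σ =>
        obtain ⟨-, rfl, rfl⟩ := ht
        refine ⟨rfl, ?_⟩
        cases y with
        | none => simpa [Move.apply] using hh
        | some y => simpa [Move.apply] using (List.getElem?_eq_some_iff.1 hx.symm).1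
      | left σ =>
        rcases m with - | ⟨- | -, m⟩
        · simp [action] at ht
        · obtain ⟨-, rfl, rfl⟩ := ht
          exact ⟨rfl, (Nat.sub_le _ _).trans hh⟩
        · obtain ⟨-, rfl, rfl⟩ := ht
          exact ⟨rfl, hh⟩
      | halt r => simp [action] at ht
    refine ⟨fun i => ?_, key.2⟩
    by_cases hi : i = c.head
    · subst hi; simpa using key.1
    · simpa [Function.update_of_ne hi] using hT i

/-- The tape after the first `i` cells of a sweep have been rewritten. -/
def tapeAt (w : List α) (σ : D.State) (τ : ℕ → D.Mark) (T : ℕ → D.Cell) (i j : ℕ) : D.Cell :=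
  if j < i then (w[j]?, some (decide (j = 0), D.markAt w σ τ j)) else T j

omit [Finite α] in
theorem tapeAt_self (w : List α) (σ : D.State) (τ : ℕ → D.Mark) (T : ℕ → D.Cell) (i : ℕ) :
    D.tapeAt w σ τ T i i = T i := by
  simp [tapeAt]

omit [Finite α] in
theorem tapeAt_succ_self (w : List α) (σ : D.State) (τ : ℕ → D.Mark) (T : ℕ → D.Cell) (i : ℕ) :
    D.tapeAt w σ τ T (i + 1) i = (w[i]?, some (decide (i = 0), D.markAt w σ τ i)) := by
  simp [tapeAt]

omit [Finite α] in
theorem tapeAt_succ_of_ne (w : List α) (σ : D.State) (τ : ℕ → D.Mark) (T : ℕ → D.Cell) {i j : ℕ}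
    (h : j ≠ i) : D.tapeAt w σ τ T (i + 1) j = D.tapeAt w σ τ T i j := by
  simp [tapeAt, show j < i + 1 ↔ j < i by omega]

omit [Finite α] in
theorem action_tapeAt {w : List α} {σ : D.State} {τ : ℕ → D.Mark} {T : ℕ → D.Cell}
    {i : ℕ} (hT : (T i).1 = w[i]?) (hτ : D.content (T i) = τ i) :
    D.action (.right (decide (i = 0)) (D.stateAt w σ τ i)) (D.tapeAt w σ τ T i i) =
      some (if (w[i]?).isSome then .right false (D.stateAt w σ τ (i + 1))
          else .left (D.stateAt w σ τ (i + 1)),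
        D.tapeAt w σ τ T (i + 1) i, if (w[i]?).isSome then .right else .stay) := by
  rw [tapeAt_self, tapeAt_succ_self, action, hT, hτ]
  rfl

theorem steps_right {w : List α} {σ : D.State} {τ : ℕ → D.Mark} {T : ℕ → D.Cell}
    (hT : ∀ i, (T i).1 = w[i]?) (hτ : ∀ i ≤ w.length, D.content (T i) = τ i) {i : ℕ} (hi : i ≤ w.length) :
    D.machine.Steps i ⟨.right true σ, 0, T⟩
      ⟨.right (decide (i = 0)) (D.stateAt w σ τ i), i, D.tapeAt w σ τ T i⟩ := by
  induction i with
  | zero =>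
    have : D.tapeAt w σ τ T 0 = T := by funext j; simp [tapeAt]
    rw [this]
    exact .refl _
  | succ i ih =>
    refine (ih (by omega)).tail ?_
    have h := D.action_tapeAt (hT i) (hτ i (by omega)) (σ := σ)
    rw [if_pos (by simpa using hi), if_pos (by simpa using hi)] at h
    exact D.machine_step h rfl rfl fun j hj => D.tapeAt_succ_of_ne w σ τ T hj

theorem steps_turn {w : List α} {σ : D.State} {τ : ℕ → D.Mark} {T : ℕ → D.Cell}
    (hT : ∀ i, (T i).1 = w[i]?) (hτ : ∀ i ≤ w.length, D.content (T i) = τ i) :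
    D.machine.Steps (w.length + 1) ⟨.right true σ, 0, T⟩
      ⟨.left (D.stateAt w σ τ (w.length + 1)), w.length, D.tapeAt w σ τ T (w.length + 1)⟩ := by
  refine (D.steps_right hT hτ le_rfl).tail ?_
  have h := D.action_tapeAt (hT w.length) (hτ _ le_rfl) (σ := σ)
  rw [if_neg (by simp), if_neg (by simp)] at h
  exact D.machine_step h rfl rfl fun j hj => D.tapeAt_succ_of_ne w σ τ T hj

theorem steps_left {w : List α} (s : D.State) {T : ℕ → D.Cell} {μ : ℕ → D.Mark} {i : ℕ}
    (hT : ∀ j ≤ i, T j = (w[j]?, some (decide (j = 0), μ j))) :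
    D.machine.Steps i ⟨.left s, i, T⟩ ⟨.left s, 0, T⟩ := by
  induction i with
  | zero => exact .refl _
  | succ i ih =>
    have h1 : D.machine.Step ⟨.left s, i + 1, T⟩ ⟨.left s, i, T⟩ :=
      D.machine_step (d := .left) (x := T (i + 1)) (by rw [hT _ le_rfl]; rfl) rfl rfl
        fun _ _ => rfl
    rw [Nat.add_comm i 1]
    have h2 := (Machine.Steps.single h1).trans (ih fun j hj => hT j (by omega))
    rwa [Nat.add_comm 1 i] at h2 ⊢

/-- The count is `|w| + 1` steps that rewrite the cells, `|w|` steps back, and one step on cell `0`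
to consult the verdict. -/
theorem steps_sweep {w : List α} {σ : D.State} {τ : ℕ → D.Mark} {T : ℕ → D.Cell}
    (hT : ∀ i, (T i).1 = w[i]?) (hτ : ∀ i ≤ w.length, D.content (T i) = τ i) :
    D.machine.Steps (2 * w.length + 2) ⟨.right true σ, 0, T⟩
      ⟨(D.verdict (D.stateAt w σ τ (w.length + 1))).elim
          (.right true (D.stateAt w σ τ (w.length + 1))) .halt, 0,
        D.tapeAt w σ τ T (w.length + 1)⟩ := by
  have h0 : D.tapeAt w σ τ T (w.length + 1) 0 = (w[0]?, some (true, D.markAt w σ τ 0)) := by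
    simp [tapeAt]
  have h : D.machine.Step ⟨.left (D.stateAt w σ τ (w.length + 1)), 0,
      D.tapeAt w σ τ T (w.length + 1)⟩ ⟨(D.verdict (D.stateAt w σ τ (w.length + 1))).elim
          (.right true (D.stateAt w σ τ (w.length + 1))) .halt, 0,
        D.tapeAt w σ τ T (w.length + 1)⟩ :=
    D.machine_step (d := .stay) (by rw [h0]; rfl) rfl h0 fun _ _ => rfl
  have hl := D.steps_left (w := w) (D.stateAt w σ τ (w.length + 1)) (i := w.length)
    (T := D.tapeAt w σ τ T (w.length + 1)) (μ := D.markAt w σ τ)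
    (fun j hj => by simp [tapeAt, Nat.lt_succ_of_le hj])
  have := ((D.steps_turn hT hτ).trans hl).tail h
  convert this using 1
  omega

/-- Tape and device are compared only on the cells `0, …, |w|`: `markAt` is defined beyond them too,
but the machine does not go there. -/
theorem steps_of_haltsIn {w : List α} {N : ℕ} {c : D.State × (ℕ → D.Mark)} {r : Bool}
    (h : HaltsIn (D.sweep w) N c r) : ∀ {T : ℕ → D.Cell}, (∀ i, (T i).1 = w[i]?) →
      (∀ i ≤ w.length, D.content (T i) = c.2 i) →
      ∃ T', D.machine.Steps (N * (2 * w.length + 2)) ⟨.right true c.1, 0, T⟩ ⟨.halt r, 0, T'⟩ := by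
  induction h with
  | @halt c r hc =>
    intro T hT hτ
    have h := D.steps_sweep hT hτ (σ := c.1)
    have hv : D.verdict (D.stateAt w c.1 c.2 (w.length + 1)) = some r := by
      unfold sweep at hc
      split at hc <;> simp_all
    rw [hv] at h
    exact ⟨_, by rw [Nat.one_mul]; exact h⟩
  | @step N c c' r hc _ ih =>
    intro T hT hτ
    have h := D.steps_sweep hT hτ (σ := c.1)
    obtain ⟨hv, rfl⟩ : D.verdict (D.stateAt w c.1 c.2 (w.length + 1)) = none ∧
        (D.stateAt w c.1 c.2 (w.length + 1), D.markAt w c.1 c.2) = c' := by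
      unfold sweep at hc
      split at hc <;> simp_all
    rw [hv] at h
    obtain ⟨T', hT'⟩ := ih (T := D.tapeAt w c.1 c.2 T (w.length + 1))
      (fun i => by unfold tapeAt; split <;> simp [hT])
      (fun i hi => by simp [tapeAt, Nat.lt_succ_of_le hi, content])
    refine ⟨T', ?_⟩
    rw [Nat.succ_mul, Nat.add_comm]
    exact h.trans hT'

variable {D}

theorem init_steps {w : List α} {N : ℕ} {r : Bool}
    (h : HaltsIn (D.sweep w) N (D.start, fun _ => D.blank) r) :
    ∃ T', D.machine.Steps (N * (2 * w.length + 2)) (D.machine.init w) ⟨.halt r, 0, T'⟩ := by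
  refine D.steps_of_haltsIn h (fun i => ?_) (fun i _ => ?_) <;>
  · simp only [machine, List.getD_eq_getElem?_getD, List.getElem?_map]
    cases w[i]? <;> rfl

/-- The accepting state is a halting state, and a deterministic machine reaches at most one halted
configuration. -/
theorem machine_language {L : Language α}
    (h : ∀ w, ∃ N r, HaltsIn (D.sweep w) N (D.start, fun _ => D.blank) r ∧ (r = true ↔ w ∈ L)) :
    D.machine.language = L := by
  ext w
  obtain ⟨N, r, hN, hr⟩ := h w
  obtain ⟨T', hT'⟩ := init_steps hN
  rw [← hr]
  constructor
  · rintro ⟨n, ⟨s, i, T⟩, hc, rfl⟩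
    have := hc.eq_of_halted_of_halted D.machine_subsingleton hT' (D.machine_halted _ _ _)
      (D.machine_halted _ _ _)
    exact (Control.halt.inj (congrArg Machine.Cfg.state this)).symm
  · rintro rfl
    exact ⟨_, _, hT', rfl⟩

theorem machine_runsInPolynomialTime (p : Polynomial ℕ)
    (h : ∀ w, ∃ N r, HaltsIn (D.sweep w) N (D.start, fun _ => D.blank) r ∧
      N ≤ p.eval w.length) :
    D.machine.RunsInPolynomialTime := by
  refine ⟨p * (2 * Polynomial.X + 2), fun w n c hc => ?_⟩
  obtain ⟨N, r, hN, hp⟩ := h w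
  obtain ⟨T', hT'⟩ := init_steps hN
  refine (hc.le_of_halted D.machine_subsingleton hT' (D.machine_halted _ _ _)).trans ?_
  rw [Polynomial.eval_mul]
  exact Nat.mul_le_mul hp (by simp)

end SweepDevice

/-! ### Counter automata -/

/-- A deterministic automaton with finitely many counters whose values are bounded by the length
of the input. A step depends on the letters of the input at the positions given by the counters
and on the order of the counters; it halts with a verdict, or sets every counter to `0` (`none`),
or to the value of a counter (`some (d, false)`), or to one more than this (`some (d, true)`). -/
structure CounterAutomaton (α : Type) where
  State : Type
  Ctr : Type
  finite_state : Finite State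
  finite_ctr : Finite Ctr
  start : State
  next : State → (Ctr → Option α) → (Ctr → Ctr → Prop) →
    Bool ⊕ (State × (Ctr → Option (Ctr × Bool)))

namespace CounterAutomaton

variable {α : Type} (A : CounterAutomaton α)

/-- The new value of a counter. -/
def assign {ι : Type} (n : ℕ) (v : ι → ℕ) : Option (ι × Bool) → ℕ
  | none => 0
  | some (d, false) => v d
  -- The cap at `n` keeps every counter on the tape: a mark on the end marker cannot move on.
  | some (d, true) => min (v d + 1) n

/-- One step on the input `w`. -/
def step (w : List α) (c : A.State × (A.Ctr → ℕ)) : Bool ⊕ (A.State × (A.Ctr → ℕ)) :=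
  (A.next c.1 (fun x => w[c.2 x]?) (fun x y => c.2 x ≤ c.2 y)).map id
    fun y => (y.1, fun x => assign w.length c.2 (y.2 x))

/-- What a sweep knows about the counters: those that have been passed, the letters at their
positions, and their order. -/
structure Knowledge where
  seen : A.Ctr → Prop
  letter : A.Ctr → Option α
  le : A.Ctr → A.Ctr → Prop

/-- The state of the simulating device during a sweep. -/
structure SweepState where
  state : A.State
  ops : A.Ctr → Option (A.Ctr × Bool)
  prev : Option (A.Ctr → Prop)
  known : A.Knowledge

/-- The marks that a sweep writes into a cell. -/
def newMark (s : A.SweepState) (x : Option α) (m : A.Ctr → Prop) (c : A.Ctr) : Prop :=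
  match s.ops c with
  -- There is no previous cell exactly in cell `0`.
  | none => s.prev = none
  | some (d, false) => m d
  -- An increment moves the mark one cell to the right, which is why the sweep carries the old marks
  -- of the previous cell. The second alternative is the cap at the end marker.
  | some (d, true) => (∃ m' ∈ s.prev, m' d) ∨ x = none ∧ m d

/-- Update the knowledge when the marks `m` are found in a cell with the letter `x`. -/
noncomputable def Knowledge.update {A : CounterAutomaton α} (k : A.Knowledge) (x : Option α)
    (m : A.Ctr → Prop) : A.Knowledge where
  seen c := k.seen c ∨ m c
  letter c := open Classical in if m c then x else k.letter c
  -- The comparison is decided in the cell of `d`, by whether `c` has been met by then.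
  le c d := m d ∧ (k.seen c ∨ m c) ∨ ¬ m d ∧ k.le c d

/-- The knowledge at the start of a sweep. -/
def Knowledge.empty : A.Knowledge := ⟨fun _ => False, fun _ => none, fun _ _ => False⟩

/-- The sweeping device of a counter automaton. The value of a counter is marked in the cell with
this number. A sweep performs the assignments of the previous step and collects all that is needed
for the next one. -/
noncomputable def device [Finite α] : SweepDevice α where
  State := Bool ⊕ A.SweepState
  Mark := A.Ctr → Prop
  finite_state := by
    have := A.finite_state
    have := A.finite_ctr
    have : Finite A.Knowledge := Finite.of_injective
      (fun k => (k.seen, k.letter, k.le)) (by rintro ⟨⟩ ⟨⟩ h; simpa using h)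
    have : Finite A.SweepState := Finite.of_injective
      (fun s => (s.state, s.ops, s.prev, s.known)) (by rintro ⟨⟩ ⟨⟩ h; simpa using h)
    infer_instance
  finite_mark := by
    have := A.finite_ctr
    infer_instance
  -- The tape carries no marks at first; the first sweep creates them by assigning `0` to every
  -- counter.
  start := .inr ⟨A.start, fun _ => none, none, .empty A⟩
  blank := fun _ => False
  next s x m :=
    match s with
    | .inl r => (.inl r, m)
    | .inr s =>
      (match x with
        | some _ => .inr ⟨s.state, s.ops, some m, s.known.update x (A.newMark s x m)⟩
        -- At the end marker all counters have been passed, so the next step of the automaton is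
        -- determined.
        | none => (A.next s.state (s.known.update x (A.newMark s x m)).letter
            (s.known.update x (A.newMark s x m)).le).map id fun y => ⟨y.1, y.2, none, .empty A⟩,
        A.newMark s x m)
  verdict s := s.elim some fun _ => none

variable {A}

/-- The marks of the previous cell. -/
def prevAt (τ : ℕ → A.Ctr → Prop) : ℕ → Option (A.Ctr → Prop)
  | 0 => none
  | i + 1 => some (τ i)

/-- The knowledge after `i` cells if the counters have the values `v`. -/
noncomputable def knowledgeAt (w : List α) (v : A.Ctr → ℕ) (i : ℕ) : A.Knowledge where
  seen c := v c < i
  letter c := if v c < i then w[v c]? else none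
  le c d := v d < i ∧ v c ≤ v d

theorem knowledgeAt_zero (w : List α) (v : A.Ctr → ℕ) : knowledgeAt w v 0 = .empty A := by
  simp [knowledgeAt, Knowledge.empty]

theorem update_knowledgeAt (w : List α) (v : A.Ctr → ℕ) (i : ℕ) :
    (knowledgeAt w v i).update w[i]? (fun c => v c = i) = knowledgeAt w v (i + 1) := by
  simp only [knowledgeAt, Knowledge.update, Knowledge.mk.injEq]
  refine ⟨?_, ?_, ?_⟩
  · funext c; exact propext (by omega)
  · funext c
    by_cases h : v c = i
    · simp [h]
    · simp [h, show v c < i + 1 ↔ v c < i by omega]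
  · funext c d; exact propext (by omega)

theorem newMark_assign {w : List α} {v : A.Ctr → ℕ} (hv : ∀ x, v x ≤ w.length)
    (s : A.SweepState) {i : ℕ} (hi : i ≤ w.length)
    (hs : s.prev = prevAt (fun j x => v x = j) i) (c : A.Ctr) :
    A.newMark s w[i]? (fun x => v x = i) c ↔ assign w.length v (s.ops c) = i := by
  unfold newMark assign
  rw [hs]
  rcases s.ops c with - | ⟨d, - | -⟩
  · cases i <;> simp [prevAt]
  · rfl
  · have := hv d
    cases i with
    | zero => simp [prevAt, -List.length_eq_zero_iff]; omega
    | succ i => simp [prevAt]; omega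

section device

variable [Finite α]

/-- The device `d` is about to perform assignments that lead to the configuration `c`. -/
def Prepared (w : List α) (c : A.State × (A.Ctr → ℕ))
    (d : A.device (α := α).State × (ℕ → A.device (α := α).Mark)) : Prop :=
  (∀ x, c.2 x ≤ w.length) ∧ ∃ ops, d.1 = .inr ⟨c.1, ops, none, .empty A⟩ ∧
    -- The condition concerns the marks that the coming sweep will write, not those on the tape, so
    -- that it also covers the unmarked tape at the start.
    ∀ i ≤ w.length, ∀ k x,
      A.newMark ⟨c.1, ops, prevAt d.2 i, k⟩ w[i]? (d.2 i) x ↔ c.2 x = i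

theorem stateAt_device {w : List α} {v : A.Ctr → ℕ} {q : A.State}
    {ops : A.Ctr → Option (A.Ctr × Bool)} {τ : ℕ → A.Ctr → Prop}
    (h : ∀ i ≤ w.length, ∀ k x, A.newMark ⟨q, ops, prevAt τ i, k⟩ w[i]? (τ i) x ↔ v x = i)
    {i : ℕ} (hi : i ≤ w.length) :
    A.device.stateAt w (.inr ⟨q, ops, none, .empty A⟩) τ i =
      .inr ⟨q, ops, prevAt τ i, knowledgeAt w v i⟩ := by
  induction i with
  | zero => rw [knowledgeAt_zero]; rfl
  | succ i ih =>
    change (A.device.next (A.device.stateAt w _ τ i) w[i]? (τ i)).1 = _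
    rw [ih (by omega), List.getElem?_eq_getElem hi]
    have := update_knowledgeAt w v i
    rw [List.getElem?_eq_getElem hi] at this
    rw [← this]
    have hm := h i (by omega) (knowledgeAt w v i)
    rw [List.getElem?_eq_getElem hi] at hm
    rw [show (fun c => v c = i) = A.newMark ⟨q, ops, prevAt τ i, knowledgeAt w v i⟩
      (some w[i]) (τ i) from funext fun x => propext (hm x).symm]
    rfl

theorem markAt_device {w : List α} {v : A.Ctr → ℕ} {q : A.State}
    {ops : A.Ctr → Option (A.Ctr × Bool)} {τ : ℕ → A.Ctr → Prop}
    (h : ∀ i ≤ w.length, ∀ k x, A.newMark ⟨q, ops, prevAt τ i, k⟩ w[i]? (τ i) x ↔ v x = i)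
    {i : ℕ} (hi : i ≤ w.length) :
    A.device.markAt w (.inr ⟨q, ops, none, .empty A⟩) τ i = fun x => v x = i := by
  change (A.device.next (A.device.stateAt w _ τ i) w[i]? (τ i)).2 = _
  rw [stateAt_device h hi]
  exact funext fun x => propext (h i hi _ x)

theorem stateAt_device_end {w : List α} {v : A.Ctr → ℕ} {q : A.State}
    {ops : A.Ctr → Option (A.Ctr × Bool)} {τ : ℕ → A.Ctr → Prop} (hv : ∀ x, v x ≤ w.length)
    (h : ∀ i ≤ w.length, ∀ k x, A.newMark ⟨q, ops, prevAt τ i, k⟩ w[i]? (τ i) x ↔ v x = i) :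
    A.device.stateAt w (.inr ⟨q, ops, none, .empty A⟩) τ (w.length + 1) =
      (A.next q (fun x => w[v x]?) (fun x y => v x ≤ v y)).map id
        fun y => ⟨y.1, y.2, none, .empty A⟩ := by
  change (A.device.next (A.device.stateAt w _ τ w.length) w[w.length]? (τ w.length)).1 = _
  rw [stateAt_device h le_rfl]
  have hm := h _ le_rfl (knowledgeAt w v w.length)
  have hu := update_knowledgeAt w v w.length
  rw [show (fun c => v c = w.length) = A.newMark ⟨q, ops, prevAt τ w.length,
      knowledgeAt w v w.length⟩ w[w.length]? (τ w.length) from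
    funext fun x => propext (hm x).symm, List.getElem?_eq_none le_rfl] at hu
  rw [List.getElem?_eq_none le_rfl]
  change (A.next q (Knowledge.update _ _ _).letter (Knowledge.update _ _ _).le).map id _ = _
  rw [hu]
  have h1 : (knowledgeAt w v (w.length + 1)).letter = fun x => w[v x]? := by
    funext x; have := hv x; simp [knowledgeAt]; omega
  have h2 : (knowledgeAt w v (w.length + 1)).le = fun x y => v x ≤ v y := by
    funext x y; have := hv y; simp [knowledgeAt]; omega
  rw [h1, h2]

omit [Finite α] in
theorem assign_le {w : List α} {v : A.Ctr → ℕ} (hv : ∀ x, v x ≤ w.length)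
    (o : Option (A.Ctr × Bool)) : assign w.length v o ≤ w.length := by
  rcases o with - | ⟨d, - | -⟩ <;> simp [assign, hv]

theorem haltsIn_device {w : List α} {N : ℕ} {r : Bool}
    (h : HaltsIn (A.step w) N (A.start, fun _ => 0) r) :
    HaltsIn (A.device.sweep w) N (A.device.start, fun _ => A.device.blank) r := by
  refine h.simulate (Prepared w) ?_ ?_ ?_
  · rintro ⟨q, v⟩ ⟨s, τ⟩ r ⟨hv, ops, hs, hm⟩ hc
    dsimp only at hs hm hv
    subst hs
    unfold SweepDevice.sweep
    dsimp only
    rw [stateAt_device_end hv hm]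
    unfold step at hc
    dsimp only at hc
    cases hn : A.next q (fun x => w[v x]?) (fun x y => v x ≤ v y) with
    | inl r' =>
      rw [hn] at hc
      simpa [device] using hc
    | inr y => rw [hn] at hc; simp at hc
  · rintro ⟨q, v⟩ ⟨s, τ⟩ c' ⟨hv, ops, hs, hm⟩ hc
    dsimp only at hs hm hv
    subst hs
    unfold SweepDevice.sweep
    dsimp only
    rw [stateAt_device_end hv hm]
    unfold step at hc
    dsimp only at hc
    cases hn : A.next q (fun x => w[v x]?) (fun x y => v x ≤ v y) with
    | inl r' => rw [hn] at hc; simp at hc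
    | inr y =>
      rw [hn] at hc
      simp only [Sum.map_inr, Sum.inr.injEq] at hc
      subst hc
      refine ⟨_, rfl, fun x => assign_le hv _, y.2, rfl, fun i hi k x => ?_⟩
      dsimp only
      have := markAt_device hm hi
      rw [this]
      refine newMark_assign hv ⟨y.1, y.2, _, k⟩ hi ?_ x
      cases i with
      | zero => rfl
      | succ i => exact congrArg some (markAt_device hm (by omega))
  · refine ⟨fun _ => Nat.zero_le _, fun _ => none, rfl, fun i hi k x => ?_⟩
    cases i <;> simp [newMark, prevAt]

end device

end CounterAutomaton

/-! ### Rewriting one or two entries of an indexed list -/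

namespace List

/-- This locates the symbol that a production rewrites: sentential forms of configurations have the
form `w.mapIdx f`, and a change of `f` at one index changes one symbol. -/
theorem mapIdx_replace_one {α β : Type*} {f : ℕ → α → β} {w : List α} {u v : List β} {x : β}
    (h : w.mapIdx f = u ++ [x] ++ v) :
    ∃ a, w[u.length]? = some a ∧ f u.length a = x ∧
      ∀ g : ℕ → α → β, (∀ i ≠ u.length, ∀ b, w[i]? = some b → g i b = f i b) →
        w.mapIdx g = u ++ [g u.length a] ++ v := by
  have hi (i : ℕ) : (w[i]?).map (f i) = (u ++ [x] ++ v)[i]? := by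
    rw [← h, List.getElem?_mapIdx]
  have hu := hi u.length
  simp only [append_assoc, cons_append, nil_append, getElem?_append_right le_rfl, Nat.sub_self,
    getElem?_cons_zero, Option.map_eq_some_iff] at hu
  obtain ⟨a, ha, hx⟩ := hu
  refine ⟨a, ha, hx, fun g hg => ext_getElem? fun i => ?_⟩
  rw [getElem?_mapIdx]
  rcases eq_or_ne i u.length with rfl | hne
  · simp [ha]
  · have h1 : (w[i]?).map (g i) = (w[i]?).map (f i) := by
      cases hw : w[i]? with
      | none => rfl
      | some b => simp [hg i hne b hw]
    rw [h1, hi]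
    simp only [append_assoc, cons_append, nil_append, getElem?_append]
    split
    · rfl
    · rw [getElem?_cons, getElem?_cons, if_neg (by omega), if_neg (by omega)]

theorem mapIdx_replace_two {α β : Type*} {f : ℕ → α → β} {w : List α} {u v : List β} {x y : β}
    (h : w.mapIdx f = u ++ [x, y] ++ v) :
    ∃ a b, w[u.length]? = some a ∧ w[u.length + 1]? = some b ∧ f u.length a = x ∧
      f (u.length + 1) b = y ∧
      ∀ g : ℕ → α → β,
        (∀ i, i ≠ u.length → i ≠ u.length + 1 → ∀ b, w[i]? = some b → g i b = f i b) →
        w.mapIdx g = u ++ [g u.length a, g (u.length + 1) b] ++ v := by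
  obtain ⟨a, ha, hx, h1⟩ := mapIdx_replace_one (u := u) (x := x) (v := y :: v)
    (h.trans (by simp))
  obtain ⟨b, hb, hy, -⟩ := mapIdx_replace_one (u := u ++ [x]) (x := y) (v := v)
    (h.trans (by simp))
  rw [length_append, length_singleton] at hb hy
  refine ⟨a, b, ha, hb, hx, hy, fun g hg => ?_⟩
  -- The two entries are replaced one after the other; `g'` is the intermediate function.
  set g' : ℕ → α → β := fun i c => if i = u.length then g i c else f i c with hg'
  have h2 := h1 g' fun i hi c _ => by simp [hg', hi]
  obtain ⟨b', hb', -, h3⟩ := mapIdx_replace_one (u := u ++ [g' u.length a]) (x := y) (v := v)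
    (h2.trans (by simp))
  rw [length_append, length_singleton] at hb' h3
  obtain rfl : b = b' := Option.some.inj (hb.symm.trans hb')
  rw [h3 g fun i hi c hc => ?_]
  · simp [hg']
  · by_cases h4 : i = u.length
    · simp [hg', h4]
    · simp [hg', h4, hg i h4 hi c hc]

end List

/-! ### From linear-bounded automata to context-sensitive grammars -/

namespace NTuring.Machine

variable {T : Type} (M : Machine T)

/-- A nonterminal that represents one cell: the input letter, whether this is cell `0`, the tape
symbol, the state if the head is here, and, in the last cell of the input, also the symbol of the
next cell to the right. The flag next to the state tells whether the head is on that extra cell. -/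
structure GrammarCell where
  letter : T
  first : Bool
  symbol : M.TapeSymbol
  head : Option (M.State × Bool)
  extra : Option M.TapeSymbol

/-- The nonterminals of the grammar of a linear-bounded automaton. -/
inductive GrammarSymbol where
  | start
  | more
  | cell (x : M.GrammarCell)

/-- A cell, as a symbol of the grammar. -/
abbrev cellSymbol (x : M.GrammarCell) : Symbol T M.GrammarSymbol :=
  .nonterminal (.cell x)

/-- The productions: generate an initial configuration, simulate the machine, and turn the cells
into the input letters once an accepting state has been reached. -/
inductive Production : List (Symbol T M.GrammarSymbol) → List (Symbol T M.GrammarSymbol) → Prop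
  | single (a : T) : Production [.nonterminal .start]
      [M.cellSymbol ⟨a, true, M.embed a, some (M.start, false), some M.blank⟩]
  -- The input is generated from right to left, so the cell that also stores the extra blank comes
  -- first.
  | last (a : T) : Production [.nonterminal .start]
      [.nonterminal .more, M.cellSymbol ⟨a, false, M.embed a, none, some M.blank⟩]
  | middle (a : T) : Production [.nonterminal .more]
      [.nonterminal .more, M.cellSymbol ⟨a, false, M.embed a, none, none⟩]
  | first (a : T) : Production [.nonterminal .more]
      [M.cellSymbol ⟨a, true, M.embed a, some (M.start, false), none⟩]
  | stay {s s' : M.State} {x y : M.TapeSymbol} (h : (s', y, Move.stay) ∈ M.trans s x)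
      (a : T) (b : Bool) (e : Option M.TapeSymbol) :
      Production [M.cellSymbol ⟨a, b, x, some (s, false), e⟩]
        [M.cellSymbol ⟨a, b, y, some (s', false), e⟩]
  | leftEnd {s s' : M.State} {x y : M.TapeSymbol} (h : (s', y, Move.left) ∈ M.trans s x)
      (a : T) (e : Option M.TapeSymbol) :
      Production [M.cellSymbol ⟨a, true, x, some (s, false), e⟩]
        [M.cellSymbol ⟨a, true, y, some (s', false), e⟩]
  | toExtra {s s' : M.State} {x y : M.TapeSymbol} (h : (s', y, Move.right) ∈ M.trans s x)
      (a : T) (b : Bool) (z : M.TapeSymbol) :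
      Production [M.cellSymbol ⟨a, b, x, some (s, false), some z⟩]
        [M.cellSymbol ⟨a, b, y, some (s', true), some z⟩]
  | stayExtra {s s' : M.State} {x y : M.TapeSymbol} (h : (s', y, Move.stay) ∈ M.trans s x)
      (a : T) (b : Bool) (z : M.TapeSymbol) :
      Production [M.cellSymbol ⟨a, b, z, some (s, true), some x⟩]
        [M.cellSymbol ⟨a, b, z, some (s', true), some y⟩]
  -- A move to the right from the extra cell has no production; a linear-bounded machine never makes
  -- it.
  | fromExtra {s s' : M.State} {x y : M.TapeSymbol} (h : (s', y, Move.left) ∈ M.trans s x)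
      (a : T) (b : Bool) (z : M.TapeSymbol) :
      Production [M.cellSymbol ⟨a, b, z, some (s, true), some x⟩]
        [M.cellSymbol ⟨a, b, z, some (s', false), some y⟩]
  | left {s s' : M.State} {x y : M.TapeSymbol} (h : (s', y, Move.left) ∈ M.trans s x)
      (a a' : T) (b : Bool) (z : M.TapeSymbol) (e : Option M.TapeSymbol) :
      Production [M.cellSymbol ⟨a, b, z, none, none⟩,
          M.cellSymbol ⟨a', false, x, some (s, false), e⟩]
        [M.cellSymbol ⟨a, b, z, some (s', false), none⟩, M.cellSymbol ⟨a', false, y, none, e⟩]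
  | right {s s' : M.State} {x y : M.TapeSymbol} (h : (s', y, Move.right) ∈ M.trans s x)
      (a a' : T) (b : Bool) (z : M.TapeSymbol) (e : Option M.TapeSymbol) :
      Production [M.cellSymbol ⟨a, b, x, some (s, false), none⟩,
          M.cellSymbol ⟨a', false, z, none, e⟩]
        [M.cellSymbol ⟨a, b, y, none, none⟩, M.cellSymbol ⟨a', false, z, some (s', false), e⟩]
  -- Only this production creates a terminal without having one on its left-hand side; the next two
  -- spread from it in both directions.
  | accept {s : M.State} (h : s ∈ M.accept) (a : T) (b : Bool) (x : M.TapeSymbol) (i : Bool)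
      (e : Option M.TapeSymbol) :
      Production [M.cellSymbol ⟨a, b, x, some (s, i), e⟩] [.terminal a]
  | spreadRight (a : T) (x : M.GrammarCell) :
      Production [.terminal a, M.cellSymbol x] [.terminal a, .terminal x.letter]
  | spreadLeft (x : M.GrammarCell) (a : T) :
      Production [M.cellSymbol x, .terminal a] [.terminal x.letter, .terminal a]

/-- The first bound says that nothing contracts; together with the second it leaves only finitely
many productions over the finite alphabet. -/
theorem Production.bounds {M : Machine T} {x y : List (Symbol T M.GrammarSymbol)}
    (h : M.Production x y) : x.length ≤ y.length ∧ y.length ≤ 2 ∧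
      ∃ A, Symbol.nonterminal A ∈ x := by
  cases h <;> simp

instance [Finite T] : Finite M.GrammarSymbol := by
  have := M.finite_state
  have := M.finite_tapeSymbol
  have : Finite M.GrammarCell := Finite.of_injective
    (fun x => (x.letter, x.first, x.symbol, x.head, x.extra))
    (by rintro ⟨⟩ ⟨⟩ h; simpa using h)
  exact Finite.of_surjective
    (fun x : Option (Option M.GrammarCell) => x.elim .start fun y => y.elim .more .cell)
    (fun x => match x with
      | .start => ⟨none, rfl⟩
      | .more => ⟨some none, rfl⟩
      | .cell x => ⟨some (some x), rfl⟩)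

/-- The grammar of a linear-bounded automaton. -/
@[reducible] def grammar [Finite T] : PhraseGrammar T where
  NT := M.GrammarSymbol
  finite_NT := inferInstance
  start := .start
  rules := {ρ | M.Production ρ.1 ρ.2}
  finite_rules := by
    have := M.finite_state
    have := M.finite_tapeSymbol
    have : Finite (Symbol T M.GrammarSymbol) := Finite.of_surjective
      (Sum.elim Symbol.terminal Symbol.nonterminal)
      (fun x => match x with
        | .terminal a => ⟨.inl a, rfl⟩
        | .nonterminal A => ⟨.inr A, rfl⟩)
    refine ((List.finite_length_le (Symbol T M.GrammarSymbol) 2).prod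
      (List.finite_length_le _ 2)).subset fun ρ h => ?_
    have := Production.bounds h
    exact ⟨this.1.trans this.2.1, this.2.1⟩
  exists_nonterminal ρ h := h.bounds.2.2

theorem grammar_isContextSensitive [Finite T] : M.grammar.IsContextSensitive :=
  fun _ h => .inl (Production.bounds h).1

/-- The cell `i` of a configuration on an input of length `n` with the letter `a` at `i`. -/
def cellAt (n : ℕ) (c : M.Cfg) (i : ℕ) (a : T) : M.GrammarCell where
  letter := a
  first := decide (i = 0)
  symbol := c.tape i
  head := if c.head = i then some (c.state, false)
    else if i + 1 = n ∧ c.head = n then some (c.state, true) else none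
  extra := if i + 1 = n then some (c.tape n) else none

/-- The sentential form of a configuration. -/
def form (w : List T) (c : M.Cfg) : List (Symbol T M.GrammarSymbol) :=
  w.mapIdx fun i a => M.cellSymbol (M.cellAt w.length c i a)

/-- The cells to the right of cell `0` in the initial configuration. -/
def initialTail (w : List T) : List (Symbol T M.GrammarSymbol) :=
  w.mapIdx fun i a => M.cellSymbol
    ⟨a, false, M.embed a, none, if i + 1 = w.length then some M.blank else none⟩

variable {M}

theorem initialTail_cons (a : T) (w : List T) : M.initialTail (a :: w) =
    M.cellSymbol ⟨a, false, M.embed a, none, if w = [] then some M.blank else none⟩ ::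
      M.initialTail w := by
  simp [initialTail, eq_comm]

theorem form_init_cons (a : T) (w : List T) : M.form (a :: w) (M.init (a :: w)) =
    M.cellSymbol ⟨a, true, M.embed a, some (M.start, false), if w = [] then some M.blank else none⟩
      :: M.initialTail w := by
  simp only [form, List.mapIdx_cons, initialTail, List.cons.injEq]
  constructor
  · cases w <;> simp [cellAt, init]
  · refine List.ext_getElem? fun i => ?_
    rw [List.getElem?_mapIdx, List.getElem?_mapIdx]
    cases hi : w[i]? with
    | none => rfl
    | some b =>
      have h := (List.getElem?_eq_some_iff.1 hi).1
      simp [cellAt, init, hi]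

/-! ### Computations as derivations. -/

variable [Finite T]

theorem produces_of_production {x y : List (Symbol T M.GrammarSymbol)} (h : M.Production x y)
    (u v : List (Symbol T M.GrammarSymbol)) :
    M.grammar.Produces (u ++ x ++ v) (u ++ y ++ v) :=
  ⟨(x, y), h, u, v, rfl, rfl⟩

open Relation in
theorem derives_initialTail {w : List T} (hw : w ≠ []) :
    ReflTransGen M.grammar.Produces [.nonterminal .start]
      (.nonterminal .more :: M.initialTail w) := by
  induction w with
  | nil => exact absurd rfl hw
  | cons a w ih =>
    rw [initialTail_cons]
    rcases eq_or_ne w [] with rfl | hne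
    · exact .single (produces_of_production (.last a) [] [])
    · refine (ih hne).tail ?_
      rw [if_neg hne]
      exact produces_of_production (.middle a) [] _

open Relation in
theorem derives_init {w : List T} (hw : w ≠ []) :
    ReflTransGen M.grammar.Produces [.nonterminal .start] (M.form w (M.init w)) := by
  cases w with
  | nil => exact absurd rfl hw
  | cons a w =>
    rw [form_init_cons]
    rcases eq_or_ne w [] with rfl | hne
    · exact .single (produces_of_production (.single a) [] [])
    · refine (derives_initialTail hne).tail ?_
      rw [if_neg hne]
      exact produces_of_production (.first a) [] _

theorem produces_one {w : List T} {c c' : M.Cfg} {i : ℕ} {a : T} (hi : w[i]? = some a)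
    (hc : ∀ j < w.length, j ≠ i → ∀ b, M.cellAt w.length c' j b = M.cellAt w.length c j b)
    (h : M.Production [M.cellSymbol (M.cellAt w.length c i a)]
      [M.cellSymbol (M.cellAt w.length c' i a)]) :
    M.grammar.Produces (M.form w c) (M.form w c') := by
  obtain ⟨hi', rfl⟩ := List.getElem?_eq_some_iff.1 hi
  have hlen : i < (M.form w c).length := by simpa [form] using hi'
  have hs : M.form w c = (M.form w c).take i ++ [M.cellSymbol (M.cellAt w.length c i w[i])] ++
      (M.form w c).drop (i + 1) := by
    conv_lhs => rw [← List.take_append_drop i (M.form w c), List.drop_eq_getElem_cons hlen]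
    simp [form]
  obtain ⟨b, hb, -, hf⟩ := List.mapIdx_replace_one hs
  have hli : ((M.form w c).take i).length = i := by simp; omega
  rw [hli] at hb hf
  obtain rfl : w[i] = b := Option.some.inj (hi.symm.trans hb)
  have hf' := hf (fun j b => M.cellSymbol (M.cellAt w.length c' j b)) fun j hj b hb => by
    rw [hc j (List.getElem?_eq_some_iff.1 hb).1 hj]
  have hp := produces_of_production h ((M.form w c).take i) ((M.form w c).drop (i + 1))
  rwa [← hs, ← hf'] at hp

theorem produces_two {w : List T} {c c' : M.Cfg} {i : ℕ} {a b : T} (hi : w[i]? = some a)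
    (hi1 : w[i + 1]? = some b)
    (hc : ∀ j < w.length, j ≠ i → j ≠ i + 1 → ∀ b,
      M.cellAt w.length c' j b = M.cellAt w.length c j b)
    (h : M.Production
      [M.cellSymbol (M.cellAt w.length c i a), M.cellSymbol (M.cellAt w.length c (i + 1) b)]
      [M.cellSymbol (M.cellAt w.length c' i a), M.cellSymbol (M.cellAt w.length c' (i + 1) b)]) :
    M.grammar.Produces (M.form w c) (M.form w c') := by
  obtain ⟨hi', rfl⟩ := List.getElem?_eq_some_iff.1 hi
  obtain ⟨hi1', rfl⟩ := List.getElem?_eq_some_iff.1 hi1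
  have hlen : i + 1 < (M.form w c).length := by simpa [form] using hi1'
  have hs : M.form w c = (M.form w c).take i ++ [M.cellSymbol (M.cellAt w.length c i w[i]),
      M.cellSymbol (M.cellAt w.length c (i + 1) w[i + 1])] ++ (M.form w c).drop (i + 2) := by
    conv_lhs => rw [← List.take_append_drop i (M.form w c),
      List.drop_eq_getElem_cons (show i < _ by omega), List.drop_eq_getElem_cons hlen]
    simp [form]
  obtain ⟨a', b', ha, hb, -, -, hf⟩ := List.mapIdx_replace_two hs
  have hli : ((M.form w c).take i).length = i := by simp; omega
  rw [hli] at ha hb hf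
  obtain rfl : w[i] = a' := Option.some.inj (hi.symm.trans ha)
  obtain rfl : w[i + 1] = b' := Option.some.inj (hi1.symm.trans hb)
  have hf' := hf (fun j b => M.cellSymbol (M.cellAt w.length c' j b)) fun j hj hj1 b hb => by
    rw [hc j (List.getElem?_eq_some_iff.1 hb).1 hj hj1]
  have hp := produces_of_production h ((M.form w c).take i) ((M.form w c).drop (i + 2))
  rwa [← hs, ← hf'] at hp

omit [Finite T] in
/-- The cell that carries the head. -/
theorem cellAt_head {n : ℕ} {c : M.Cfg} {i : ℕ} (hi : c.head = i) (a : T) :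
    M.cellAt n c i a = ⟨a, decide (i = 0), c.tape i, some (c.state, false),
      if i + 1 = n then some (c.tape n) else none⟩ := by
  simp [cellAt, hi]

omit [Finite T] in
/-- The last cell, if the head is on the extra cell. -/
theorem cellAt_extra {n : ℕ} {c : M.Cfg} {i : ℕ} (hi : c.head = n) (hn : i + 1 = n) (a : T) :
    M.cellAt n c i a = ⟨a, decide (i = 0), c.tape i, some (c.state, true), some (c.tape n)⟩ := by
  simp [cellAt, hi, hn, show n ≠ i by omega]

omit [Finite T] in
theorem cellAt_other {n : ℕ} {c : M.Cfg} {i : ℕ} (hi : c.head ≠ i) (hn : i + 1 = n → c.head ≠ n)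
    (a : T) : M.cellAt n c i a = ⟨a, decide (i = 0), c.tape i, none,
      if i + 1 = n then some (c.tape n) else none⟩ := by
  by_cases h : i + 1 = n <;> simp [cellAt, hi, h, hn]

omit [Finite T] in
/-- Only the cells under the head change in a step. -/
theorem cellAt_congr {n : ℕ} {c c' : M.Cfg} {i j : ℕ} (hi : c.head = i) (a : T) (h1 : c.head ≠ j)
    (h2 : c'.head ≠ j) (hn : j + 1 = n → c.head ≠ n ∧ c'.head ≠ n)
    (ht : ∀ k ≠ i, c'.tape k = c.tape k) : M.cellAt n c' j a = M.cellAt n c j a := by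
  subst hi
  rw [cellAt_other h1 fun h => (hn h).1, cellAt_other h2 fun h => (hn h).2, ht j h1.symm]
  split
  · rename_i h; rw [ht n (hn h).1.symm]
  · rfl

theorem produces_step {w : List T} {c c' : M.Cfg} (h : M.Step c c') (hw : w ≠ [])
    (hc : c.head ≤ w.length) (hc' : c'.head ≤ w.length) :
    M.grammar.Produces (M.form w c) (M.form w c') := by
  obtain ⟨s, x, d, ht, hc''⟩ := h
  have hpos := List.length_pos_iff.2 hw
  have hstate : c'.state = s := by rw [hc'']
  have hhead : c'.head = d.apply c.head := by rw [hc'']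
  have htape : c'.tape c.head = x := by rw [hc'']; simp
  have hrest : ∀ k ≠ c.head, c'.tape k = c.tape k := by
    intro k hk; rw [hc'']; simp [hk]
  clear hc''
  obtain ⟨i, hi⟩ : ∃ i, c.head = i := ⟨_, rfl⟩
  -- The head is either on a cell of the input or on the extra cell.
  rcases hc.lt_or_eq with hlt | heq
  · rw [hi] at ht htape hrest hlt
    have hw : w[i]? = some w[i] := List.getElem?_eq_getElem hlt
    cases d with
    | stay =>
      simp only [Move.apply] at hhead
      refine produces_one hw (fun j hj hji b => cellAt_congr hi b (by omega) (by omega)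
        (by omega) hrest) ?_
      rw [cellAt_head hi, cellAt_head (hhead.trans hi), htape, hstate,
        hrest _ hlt.ne']
      exact .stay ht _ _ _
    | left =>
      simp only [Move.apply] at hhead
      rcases Nat.eq_zero_or_pos i with h0 | h0
      · refine produces_one hw (fun j hj hji b => cellAt_congr hi b (by omega) (by omega)
          (by omega) hrest) ?_
        rw [cellAt_head hi, cellAt_head (show c'.head = i by omega), htape, hstate,
          hrest _ hlt.ne', decide_eq_true h0]
        exact .leftEnd ht _ _
      · obtain ⟨i, rfl⟩ : ∃ k, i = k + 1 := ⟨i - 1, by omega⟩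
        refine produces_two (List.getElem?_eq_getElem (by omega)) hw
          (fun j hj hji hji' b => cellAt_congr hi b (by omega) (by omega) (by omega) hrest) ?_
        rw [cellAt_head hi, cellAt_head (show c'.head = i by omega),
          cellAt_other (by omega) (by omega), cellAt_other (by omega) (by omega), htape,
          hstate, hrest _ hlt.ne', hrest i (by omega), if_neg (by omega),
          decide_eq_false (show ¬ i + 1 = 0 by omega)]
        exact .left ht _ _ _ _ _
    | right =>
      simp only [Move.apply] at hhead
      by_cases hn : i + 1 = w.length
      · refine produces_one hw (fun j hj hji b => cellAt_congr hi b (by omega) (by omega)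
          (by omega) hrest) ?_
        rw [cellAt_head hi, cellAt_extra (by omega) hn, htape, hstate, hrest _ hlt.ne',
          if_pos (by omega)]
        exact .toExtra ht _ _ _
      · refine produces_two hw (List.getElem?_eq_getElem (by omega))
          (fun j hj hji hji' b => cellAt_congr hi b (by omega) (by omega) (by omega) hrest) ?_
        rw [cellAt_head hi, cellAt_head (show c'.head = i + 1 by omega),
          cellAt_other (by omega) (by omega), cellAt_other (by omega) (by omega), htape, if_neg hn, if_neg hn,
          hstate, hrest _ hlt.ne', hrest (i + 1) (by omega),
          decide_eq_false (show ¬ i + 1 = 0 by omega)]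
        exact .right ht _ _ _ _ _
  · obtain ⟨k, hk⟩ : ∃ k, k + 1 = w.length := ⟨w.length - 1, by omega⟩
    have hw : w[k]? = some w[k] := List.getElem?_eq_getElem (by omega)
    rw [heq] at ht htape hrest
    cases d with
    | stay =>
      simp only [Move.apply] at hhead
      refine produces_one hw (fun j hj hji b => cellAt_congr heq b (by omega) (by omega)
        (by omega) hrest) ?_
      rw [cellAt_extra heq hk, cellAt_extra (by omega) hk, htape, hstate, hrest k (by omega)]
      exact .stayExtra ht _ _ _
    | left =>
      simp only [Move.apply] at hhead
      refine produces_one hw (fun j hj hji b => cellAt_congr heq b (by omega) (by omega)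
        (by omega) hrest) ?_
      rw [cellAt_extra heq hk, cellAt_head (by omega), if_pos hk, htape, hstate,
        hrest k (by omega)]
      exact .fromExtra ht _ _ _
    | right =>
      -- This move would leave the allowed cells, contrary to `hc'`.
      simp only [Move.apply] at hhead
      omega

/-! ### Derivations as computations. -/

omit [Finite T] in
theorem form_eq_append_one {w : List T} {c : M.Cfg} {u v : List (Symbol T M.GrammarSymbol)}
    {x : M.GrammarCell} (h : M.form w c = u ++ [M.cellSymbol x] ++ v) :
    ∃ i a, i < w.length ∧ M.cellAt w.length c i a = x ∧
      ∀ c', (∀ j < w.length, j ≠ i → ∀ b, M.cellAt w.length c' j b = M.cellAt w.length c j b) →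
        M.form w c' = u ++ [M.cellSymbol (M.cellAt w.length c' i a)] ++ v := by
  obtain ⟨a, ha, hx, hf⟩ := List.mapIdx_replace_one h
  refine ⟨u.length, a, (List.getElem?_eq_some_iff.1 ha).1, by simpa using hx, fun c' hc => ?_⟩
  exact hf (fun j b => M.cellSymbol (M.cellAt w.length c' j b)) fun j hj b hb => by
    rw [hc j (List.getElem?_eq_some_iff.1 hb).1 hj]

omit [Finite T] in
theorem form_eq_append_two {w : List T} {c : M.Cfg} {u v : List (Symbol T M.GrammarSymbol)}
    {x y : M.GrammarCell} (h : M.form w c = u ++ [M.cellSymbol x, M.cellSymbol y] ++ v) :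
    ∃ i a b, i + 1 < w.length ∧ M.cellAt w.length c i a = x ∧ M.cellAt w.length c (i + 1) b = y ∧
      ∀ c', (∀ j < w.length, j ≠ i → j ≠ i + 1 → ∀ b,
          M.cellAt w.length c' j b = M.cellAt w.length c j b) →
        M.form w c' = u ++ [M.cellSymbol (M.cellAt w.length c' i a),
          M.cellSymbol (M.cellAt w.length c' (i + 1) b)] ++ v := by
  obtain ⟨a, b, -, hb, hx, hy, hf⟩ := List.mapIdx_replace_two h
  refine ⟨u.length, a, b, (List.getElem?_eq_some_iff.1 hb).1, by simpa using hx,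
    by simpa using hy, fun c' hc => ?_⟩
  exact hf (fun j b => M.cellSymbol (M.cellAt w.length c' j b)) fun j hj hj1 b hb => by
    rw [hc j (List.getElem?_eq_some_iff.1 hb).1 hj hj1]

omit [Finite T] in
theorem cellAt_head_eq_some {n : ℕ} {c : M.Cfg} {i : ℕ} {a : T} {s : M.State} {e : Bool}
    (h : (M.cellAt n c i a).head = some (s, e)) :
    c.state = s ∧ (e = false ∧ c.head = i ∨ e = true ∧ i + 1 = n ∧ c.head = n) := by
  simp only [cellAt] at h
  split_ifs at h with h1 h2 <;> simp_all

omit [Finite T] in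
theorem exists_step {c : M.Cfg} {s : M.State} {y : M.TapeSymbol} {d : Move} {i : ℕ}
    (hi : c.head = i) {x : M.TapeSymbol} (h : (s, y, d) ∈ M.trans c.state x)
    (hx : x = c.tape i := by rfl) :
    ∃ c', M.Step c c' ∧ c'.state = s ∧ c'.head = d.apply c.head ∧ c'.tape i = y ∧
      ∀ k ≠ i, c'.tape k = c.tape k := by
  subst hi hx
  exact ⟨_, ⟨s, y, d, h, rfl⟩, rfl, rfl, Function.update_self .., fun k hk =>
    Function.update_of_ne hk ..⟩

omit [Finite T] in
-- The form of a configuration consists of cells and shows a single head, so a production that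
-- applies either imitates a step at that head or witnesses acceptance.
theorem form_production {w : List T} {c : M.Cfg} {x y u v : List (Symbol T M.GrammarSymbol)}
    (h : M.Production x y) (hf : M.form w c = u ++ x ++ v) :
    (∃ c', M.Step c c' ∧ u ++ y ++ v = M.form w c') ∨ c.state ∈ M.accept := by
  have hcell : ∀ s ∈ x, ∃ X, s = M.cellSymbol X := by
    intro s hs
    have : s ∈ M.form w c := by rw [hf]; simp [hs]
    obtain ⟨i, hi, rfl⟩ := List.mem_mapIdx.1 this
    exact ⟨_, rfl⟩
  cases h with
  | single | last | middle | first => simp at hcell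
  | spreadRight | spreadLeft => simp at hcell
  | @stay s s' x y h a b e =>
    obtain ⟨i, a', hi, hx, hF⟩ := form_eq_append_one hf
    obtain ⟨rfl, ⟨-, h1⟩ | ⟨h1, -⟩⟩ := cellAt_head_eq_some (congrArg (·.head) hx)
    swap; · cases h1
    rw [cellAt_head h1] at hx
    obtain ⟨rfl, rfl, rfl, -, rfl⟩ := GrammarCell.mk.inj hx
    obtain ⟨c', hc', rfl, h2, rfl, h3⟩ := exists_step h1 h
    simp only [Move.apply] at h2
    refine .inl ⟨c', hc', ?_⟩
    rw [hF c' fun j hj hji b => cellAt_congr h1 b (by omega) (by omega) (by omega) h3,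
      cellAt_head (h2.trans h1), h3 _ hi.ne']
  | @leftEnd s s' x y h a e =>
    obtain ⟨i, a', hi, hx, hF⟩ := form_eq_append_one hf
    obtain ⟨rfl, ⟨-, h1⟩ | ⟨h1, -⟩⟩ := cellAt_head_eq_some (congrArg (·.head) hx)
    swap; · cases h1
    rw [cellAt_head h1] at hx
    obtain ⟨rfl, h0, rfl, -, rfl⟩ := GrammarCell.mk.inj hx
    have h0 := of_decide_eq_true h0
    obtain ⟨c', hc', rfl, h2, rfl, h3⟩ := exists_step h1 h
    simp only [Move.apply] at h2
    refine .inl ⟨c', hc', ?_⟩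
    rw [hF c' fun j hj hji b => cellAt_congr h1 b (by omega) (by omega) (by omega) h3,
      cellAt_head (show c'.head = i by omega), h3 _ hi.ne', decide_eq_true h0]
  | @toExtra s s' x y h a b z =>
    obtain ⟨i, a', hi, hx, hF⟩ := form_eq_append_one hf
    obtain ⟨rfl, ⟨-, h1⟩ | ⟨h1, -⟩⟩ := cellAt_head_eq_some (congrArg (·.head) hx)
    swap; · cases h1
    rw [cellAt_head h1] at hx
    obtain ⟨rfl, rfl, rfl, -, h0⟩ := GrammarCell.mk.inj hx
    obtain ⟨hn, rfl⟩ : i + 1 = w.length ∧ c.tape w.length = z := by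
      split_ifs at h0 with h3; exact ⟨h3, Option.some.inj h0⟩
    obtain ⟨c', hc', rfl, h2, rfl, h3⟩ := exists_step h1 h
    simp only [Move.apply] at h2
    refine .inl ⟨c', hc', ?_⟩
    rw [hF c' fun j hj hji b => cellAt_congr h1 b (by omega) (by omega) (by omega) h3,
      cellAt_extra (by omega) hn, h3 _ hi.ne']
  | @stayExtra s s' x y h a b z =>
    obtain ⟨i, a', hi, hx, hF⟩ := form_eq_append_one hf
    obtain ⟨rfl, ⟨h1, -⟩ | ⟨-, hn, h1⟩⟩ := cellAt_head_eq_some (congrArg (·.head) hx)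
    · cases h1
    rw [cellAt_extra h1 hn] at hx
    obtain ⟨rfl, rfl, rfl, -, h0⟩ := GrammarCell.mk.inj hx
    obtain rfl := Option.some.inj h0
    obtain ⟨c', hc', rfl, h2, rfl, h3⟩ := exists_step h1 h
    simp only [Move.apply] at h2
    refine .inl ⟨c', hc', ?_⟩
    rw [hF c' fun j hj hji b => cellAt_congr h1 b (by omega) (by omega) (by omega) h3,
      cellAt_extra (by omega) hn, h3 i (by omega)]
  | @fromExtra s s' x y h a b z =>
    obtain ⟨i, a', hi, hx, hF⟩ := form_eq_append_one hf
    obtain ⟨rfl, ⟨h1, -⟩ | ⟨-, hn, h1⟩⟩ := cellAt_head_eq_some (congrArg (·.head) hx)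
    · cases h1
    rw [cellAt_extra h1 hn] at hx
    obtain ⟨rfl, rfl, rfl, -, h0⟩ := GrammarCell.mk.inj hx
    obtain rfl := Option.some.inj h0
    obtain ⟨c', hc', rfl, h2, rfl, h3⟩ := exists_step h1 h
    simp only [Move.apply] at h2
    refine .inl ⟨c', hc', ?_⟩
    rw [hF c' fun j hj hji b => cellAt_congr h1 b (by omega) (by omega) (by omega) h3,
      cellAt_head (show c'.head = i by omega), h3 i (by omega), if_pos hn]
  | @left s s' x y h a a₁ b z e =>
    obtain ⟨i, a', b', hi, hx, hy, hF⟩ := form_eq_append_two hf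
    obtain ⟨rfl, ⟨-, h1⟩ | ⟨h1, -⟩⟩ := cellAt_head_eq_some (congrArg (·.head) hy)
    swap; · cases h1
    rw [cellAt_head h1] at hy
    rw [cellAt_other (by omega) (by omega)] at hx
    obtain ⟨rfl, rfl, rfl, -, -⟩ := GrammarCell.mk.inj hx
    obtain ⟨rfl, h0, rfl, -, rfl⟩ := GrammarCell.mk.inj hy
    obtain ⟨c', hc', rfl, h2, rfl, h3⟩ := exists_step h1 h
    simp only [Move.apply] at h2
    refine .inl ⟨c', hc', ?_⟩
    rw [hF c' fun j hj hji hji' b => cellAt_congr h1 b (by omega) (by omega) (by omega) h3,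
      cellAt_head (show c'.head = i by omega),
      cellAt_other (show c'.head ≠ i + 1 by omega) (by omega), h3 i (by omega), h3 _ hi.ne', h0,
      if_neg hi.ne]
  | @right s s' x y h a a₁ b z e =>
    obtain ⟨i, a', b', hi, hx, hy, hF⟩ := form_eq_append_two hf
    obtain ⟨rfl, ⟨-, h1⟩ | ⟨h1, -⟩⟩ := cellAt_head_eq_some (congrArg (·.head) hx)
    swap; · cases h1
    rw [cellAt_head h1] at hx
    rw [cellAt_other (by omega) (by omega)] at hy
    obtain ⟨rfl, rfl, rfl, -, -⟩ := GrammarCell.mk.inj hx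
    obtain ⟨rfl, h0, rfl, -, rfl⟩ := GrammarCell.mk.inj hy
    obtain ⟨c', hc', rfl, h2, rfl, h3⟩ := exists_step h1 h
    simp only [Move.apply] at h2
    refine .inl ⟨c', hc', ?_⟩
    rw [hF c' fun j hj hji hji' b => cellAt_congr h1 b (by omega) (by omega) (by omega) h3,
      cellAt_head (show c'.head = i + 1 by omega),
      cellAt_other (show c'.head ≠ i by omega) (by omega), h3 (i + 1) (by omega),
      h3 w.length (by omega), h0, if_neg hi.ne]
  | @accept s h a b x e =>
    obtain ⟨i, a', hi, hx, -⟩ := form_eq_append_one hf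
    obtain ⟨rfl, -⟩ := cellAt_head_eq_some (congrArg (·.head) hx)
    exact .inr h

/-- The input letter of a symbol. -/
def letterOf : Symbol T M.GrammarSymbol → Option T
  | .terminal a => some a
  | .nonterminal (.cell x) => some x.letter
  | .nonterminal _ => none

omit [Finite T] in
-- Once the input has been generated its letters never change, whether they sit in cells or have
-- become terminals. Hence a derivation that passes through acceptance can end only in the accepted
-- input.
theorem Production.map_letterOf {x y : List (Symbol T M.GrammarSymbol)} (h : M.Production x y)
    (hx : none ∉ x.map letterOf) : x.map letterOf = y.map letterOf := by
  cases h <;> simp_all [letterOf]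

omit [Finite T] in
theorem map_letterOf_form (w : List T) (c : M.Cfg) : (M.form w c).map letterOf = w.map some := by
  refine List.ext_getElem? fun i => ?_
  cases h : w[i]? <;> simp [form, h, letterOf, cellAt]

omit [Finite T] in
theorem map_letterOf_production {w : List T} {x y u v : List (Symbol T M.GrammarSymbol)}
    (h : M.Production x y) (hw : (u ++ x ++ v).map letterOf = w.map some) :
    (u ++ y ++ v).map letterOf = w.map some := by
  have hx : none ∉ x.map letterOf := fun hn => by
    have : none ∈ (u ++ x ++ v).map letterOf := by
      rw [List.map_append, List.map_append]; simp only [List.mem_append]; exact .inl (.inr hn)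
    rw [hw] at this
    simp at this
  rw [← hw]
  simp only [List.map_append, h.map_letterOf hx]

omit [Finite T] in
-- While the input is being generated there is neither a head nor a terminal, so no production can
-- touch a cell.
theorem initialTail_production {w : List T} {x y u v : List (Symbol T M.GrammarSymbol)}
    (h : M.Production x y) (hw : .nonterminal .more :: M.initialTail w = u ++ x ++ v) :
    x = [.nonterminal .more] ∧ u = [] ∧ v = M.initialTail w := by
  have htail : ∀ s ∈ M.initialTail w, ∃ X, s = M.cellSymbol X ∧ X.head = none := by
    intro s hs
    obtain ⟨i, hi, rfl⟩ := List.mem_mapIdx.1 hs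
    exact ⟨_, rfl, rfl⟩
  have hmem : ∀ s ∈ x, s = .nonterminal .more ∨ ∃ X, s = M.cellSymbol X ∧ X.head = none := by
    intro s hs
    have : s ∈ .nonterminal .more :: M.initialTail w := by rw [hw]; simp [hs]
    exact (List.mem_cons.1 this).imp_right (htail s)
  obtain rfl : x = [.nonterminal .more] := by
    cases h <;> simp at hmem <;> rfl
  cases u with
  | nil => simpa [eq_comm] using hw
  | cons s u =>
    simp only [List.cons_append, List.cons.injEq] at hw
    obtain ⟨X, hX, -⟩ := htail (.nonterminal .more) (by rw [hw.2]; simp)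
    simp at hX

/-- What the words derivable in the grammar look like. -/
inductive Sentential : List (Symbol T M.GrammarSymbol) → Prop
  | start : Sentential [.nonterminal .start]
  | tail {w : List T} (hw : w ≠ []) : Sentential (.nonterminal .more :: M.initialTail w)
  | form {w : List T} (hw : w ≠ []) {n : ℕ} {c : M.Cfg} (h : M.Steps n (M.init w) c) :
      Sentential (M.form w c)
  -- After acceptance cells and terminals may mix, and only the input letters are tracked.
  | accepted {w : List T} (hw : w ∈ M.language) {x : List (Symbol T M.GrammarSymbol)}
      (hx : x.map letterOf = w.map some) : Sentential x

omit [Finite T] in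
theorem Sentential.production {x y u v : List (Symbol T M.GrammarSymbol)}
    (hx : Sentential (u ++ x ++ v)) (h : M.Production x y) : Sentential (u ++ y ++ v) := by
  generalize h1 : u ++ x ++ v = z at hx
  cases hx with
  | start =>
    obtain ⟨rfl, rfl, rfl⟩ : x = [.nonterminal .start] ∧ u = [] ∧ v = [] := by
      have hl := congrArg List.length h1
      have hne : x ≠ [] := by rintro rfl; cases h
      have := List.length_pos_iff.2 hne
      simp only [List.length_append, List.length_singleton] at hl
      obtain rfl : u = [] := List.length_eq_zero_iff.1 (by omega)
      obtain rfl : v = [] := List.length_eq_zero_iff.1 (by omega)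
      exact ⟨by simpa using h1, rfl, rfl⟩
    cases h with
    | single a =>
      have := Sentential.form (M := M) (List.cons_ne_nil a []) (.refl _)
      rw [form_init_cons] at this
      exact this
    | last a =>
      have := Sentential.tail (M := M) (List.cons_ne_nil a [])
      rw [initialTail_cons] at this
      exact this
  | @tail w hw =>
    obtain ⟨rfl, rfl, rfl⟩ := initialTail_production h h1.symm
    cases h with
    | middle a =>
      have := Sentential.tail (M := M) (List.cons_ne_nil a w)
      rw [initialTail_cons, if_neg hw] at this
      exact this
    | first a =>
      have := Sentential.form (M := M) (List.cons_ne_nil a w) (.refl _)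
      rw [form_init_cons, if_neg hw] at this
      exact this
  | form hw hs =>
    rcases form_production h h1.symm with ⟨c', hc, he⟩ | ha
    · rw [he]; exact .form hw (hs.tail hc)
    · exact .accepted ⟨_, _, hs, ha⟩ (map_letterOf_production h (by rw [h1, map_letterOf_form]))
  | accepted hw hl => exact .accepted hw (map_letterOf_production h (by rw [h1, hl]))

open Relation in
theorem Sentential.of_derives {x : List (Symbol T M.GrammarSymbol)}
    (h : ReflTransGen M.grammar.Produces [.nonterminal .start] x) : Sentential x := by
  induction h with
  | refl => exact .start
  | tail _ h ih =>
    obtain ⟨ρ, hρ, u, v, rfl, rfl⟩ := h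
    exact ih.production hρ

theorem language_grammar_le : M.grammar.language ≤ M.language := by
  intro w hw
  have := Sentential.of_derives (M := M) (x := w.map .terminal) hw
  generalize hx : w.map Symbol.terminal = x at this
  cases this with
  | start => cases w <;> simp at hx
  | tail => cases w <;> simp at hx
  | @form w' hw' =>
    cases w' with
    | nil => exact absurd rfl hw'
    | cons => cases w <;> simp [form] at hx
  | @accepted w' hw' _ hl =>
    subst hx
    obtain rfl : w = w' := by
      rw [List.map_map] at hl
      exact List.map_injective_iff.2 (Option.some_injective T) hl
    exact hw'

/-! ### Accepted words are derivable. -/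

open Relation in
theorem derives_spreadRight (u : List (Symbol T M.GrammarSymbol)) (a : T)
    (w : List M.GrammarCell) :
    ReflTransGen M.grammar.Produces (u ++ .terminal a :: w.map M.cellSymbol)
      (u ++ .terminal a :: w.map fun x => .terminal x.letter) := by
  induction w generalizing u a with
  | nil => exact .refl
  | cons x w ih =>
    have h := produces_of_production (.spreadRight a x) u (w.map M.cellSymbol)
    have h' := ih (u ++ [.terminal a]) x.letter
    simp only [List.append_assoc, List.cons_append, List.nil_append] at h h'
    exact h'.head h

open Relation in
theorem derives_spreadLeft (w : List M.GrammarCell) (a : T)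
    (v : List (Symbol T M.GrammarSymbol)) :
    ReflTransGen M.grammar.Produces (w.map M.cellSymbol ++ .terminal a :: v)
      (w.map (fun x => .terminal x.letter) ++ .terminal a :: v) := by
  induction w using List.reverseRecOn generalizing a v with
  | nil => exact .refl
  | append_singleton w x ih =>
    have h := produces_of_production (.spreadLeft x a) (w.map M.cellSymbol) v
    have h' := ih x.letter (.terminal a :: v)
    simp only [List.append_assoc, List.cons_append, List.nil_append, List.map_append,
      List.map_cons, List.map_nil] at h h' ⊢
    exact h'.head h

open Relation in
theorem derives_steps (hM : M.IsLinearBounded) {w : List T} (hw : w ≠ []) {n : ℕ} {c : M.Cfg}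
    (h : M.Steps n (M.init w) c) :
    ReflTransGen M.grammar.Produces (M.form w (M.init w)) (M.form w c) := by
  generalize hc : M.init w = c₀ at h
  induction h with
  | refl => exact .refl
  | tail h hs ih =>
    subst hc
    exact (ih rfl).tail (produces_step hs hw (Nat.le_of_lt_succ (hM _ _ _ h))
      (Nat.le_of_lt_succ (hM _ _ _ (h.tail hs))))

theorem language_le_grammar (hM : M.IsLinearBounded) (h0 : [] ∉ M.language) :
    M.language ≤ M.grammar.language := by
  rintro w ⟨n, c, hs, ha⟩
  have hw : w ≠ [] := by rintro rfl; exact h0 ⟨n, c, hs, ha⟩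
  refine ((derives_init hw).trans (derives_steps hM hw hs)).trans ?_
  set l := w.mapIdx (M.cellAt w.length c) with hl
  have hform : M.form w c = l.map M.cellSymbol := by
    refine List.ext_getElem? fun i => ?_
    cases h : w[i]? <;> simp [hl, h, form]
  have hletter : l.map (fun x => x.letter) = w := by
    refine List.ext_getElem? fun i => ?_
    cases h : w[i]? <;> simp [hl, h, cellAt]
  -- Linear boundedness ensures that some cell shows the head; the last cell does so when the head
  -- is on the extra cell.
  obtain ⟨i, hi, b, hh⟩ : ∃ i, ∃ h : i < w.length, ∃ b,
      (M.cellAt w.length c i w[i]).head = some (c.state, b) := by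
    rcases (Nat.le_of_lt_succ (hM _ _ _ hs)).lt_or_eq with h | h
    · exact ⟨_, h, false, by rw [cellAt_head rfl]⟩
    · have := List.length_pos_iff.2 hw
      exact ⟨w.length - 1, by omega, true, by rw [cellAt_extra h (by omega)]⟩
  have hmem : M.cellAt w.length c i w[i] ∈ l := List.mem_mapIdx.2 ⟨i, hi, rfl⟩
  obtain ⟨l₁, l₂, hl'⟩ := List.append_of_mem hmem
  generalize M.cellAt w.length c i w[i] = x at hh hl'
  rw [hform, ← hletter, hl']
  obtain ⟨a, e, y, y', z⟩ := x
  obtain rfl : y' = some (c.state, b) := hh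
  simp only [List.map_append, List.map_cons, List.map_map]
  have h1 := produces_of_production (.accept ha a e y b z) (l₁.map M.cellSymbol)
    (l₂.map M.cellSymbol)
  have h2 := derives_spreadRight (l₁.map M.cellSymbol) a l₂
  have h3 := derives_spreadLeft l₁ a (l₂.map fun x => .terminal x.letter)
  simp only [List.append_assoc, List.cons_append, List.nil_append] at h1
  exact (h2.trans h3).head h1

theorem IsLinearBounded.isContextSensitiveLanguage (hM : M.IsLinearBounded)
    (h0 : [] ∉ M.language) : IsContextSensitiveLanguage M.language :=
  ⟨M.grammar, M.grammar_isContextSensitive,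
    le_antisymm language_grammar_le (language_le_grammar hM h0)⟩

end NTuring.Machine

/-! ### The combinatorics of the encoding -/

theorem List.Nodup.not_sublist_swap {α : Type*} {l : List α} (h : l.Nodup) {a b : α}
    (hab : [a, b].Sublist l) : ¬ [b, a].Sublist l := by
  induction l with
  | nil => simp at hab
  | cons c l ih =>
    intro hba
    obtain ⟨hc, hl⟩ := List.nodup_cons.1 h
    rw [List.sublist_cons_iff] at hab hba
    rcases hab with hab | ⟨r, hr, hab⟩ <;> rcases hba with hba | ⟨r', hr', hba⟩
    · exact ih hl hab hba
    · obtain ⟨rfl, rfl⟩ := List.cons.inj hr'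
      exact hc (hab.subset (by simp))
    · obtain ⟨rfl, rfl⟩ := List.cons.inj hr
      exact hc (hba.subset (by simp))
    · obtain ⟨rfl, rfl⟩ := List.cons.inj hr
      obtain ⟨rfl, rfl⟩ := List.cons.inj hr'
      exact hc (hab.subset (by simp))

/-- A list is a sublist of a list without repetitions if this holds for all pairs of entries. -/
theorem List.Nodup.sublist_of_pairwise {α : Type*} {l : List α} (h : l.Nodup) {s : List α}
    (hs : ∀ a ∈ s, a ∈ l) (hp : s.Pairwise fun a b => [a, b].Sublist l) : s.Sublist l := by
  induction l generalizing s with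
  | nil =>
    cases s with
    | nil => exact .slnil
    | cons a s => simpa using hs a (by simp)
  | cons c l ih =>
    obtain ⟨hc, hl⟩ := List.nodup_cons.1 h
    have drop_head {a b : α} (hac : a ≠ c) (hab : [a, b].Sublist (c :: l)) : [a, b].Sublist l := by
      rw [List.sublist_cons_iff] at hab
      rcases hab with hab | ⟨r, hr, -⟩
      · exact hab
      · exact absurd (List.cons.inj hr).1 hac
    cases s with
    | nil => exact List.nil_sublist _
    | cons a s =>
      obtain ⟨ha, hp⟩ := List.pairwise_cons.1 hp
      by_cases hac : a = c
      · subst hac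
        have hmem : ∀ b ∈ s, b ∈ l := by
          intro b hb
          have := ha b hb
          rw [List.sublist_cons_iff] at this
          rcases this with h' | ⟨r, hr, h'⟩
          · exact h'.subset (by simp)
          · obtain ⟨-, rfl⟩ := List.cons.inj hr
            exact h'.subset (by simp)
        refine (ih hl hmem (hp.imp_of_mem fun {b d} hb _ hbd => drop_head ?_ hbd)).cons_cons a
        rintro rfl
        exact hc (hmem b hb)
      · have hsl : ∀ b ∈ s, b ∈ l := fun b hb => (drop_head hac (ha b hb)).subset (by simp)
        refine (ih hl (fun b hb => ?_) ?_).cons c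
        · rcases List.mem_cons.1 hb with rfl | hb
          · exact (List.mem_cons.1 (hs b (by simp))).resolve_left hac
          · exact hsl b hb
        · refine List.pairwise_cons.2 ⟨fun b hb => drop_head hac (ha b hb),
            hp.imp_of_mem fun {b d} hb _ hbd => drop_head ?_ hbd⟩
          rintro rfl
          exact hc (hsl b hb)

namespace ItEncoding

/-! ### Insertion order and left-to-right order of the entries. -/

/-- The state after reading a word. -/
def stateOf (w : List Letter) : BuildState :=
  w.foldl BuildState.read ⟨[none], 1, 0⟩

/-- The entries that have been inserted. -/
def entries (w : List Letter) : List ℕ :=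
  (stateOf w).perm.reduceOption

theorem decode_eq_entries (w : List Letter) : decode w = entries w := rfl

theorem stateOf_append_singleton (w : List Letter) (x : Letter) :
    stateOf (w ++ [x]) = (stateOf w).read x := by
  simp [stateOf]

/-- The number of slots to the left of a new entry that a letter leaves open. -/
def Letter.leftSlots : Letter → ℕ
  | .r => 1
  | .m => 1
  | _ => 0

/-- The number of slots to the right of a new entry that a letter leaves open. -/
def Letter.rightSlots : Letter → ℕ
  | .l => 1
  | .m => 1
  | _ => 0

/-- The block that replaces a slot. -/
def block (x : Letter) (e : ℕ) : List (Option ℕ) :=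
  List.replicate x.leftSlots none ++ some e :: List.replicate x.rightSlots none

theorem read_of_ne {x : Letter} (hx : x ≠ .t) (σ : BuildState) :
    σ.read x = ⟨replaceSlot σ.slot (block x σ.next) σ.perm, σ.next + 1, 0⟩ := by
  cases x <;> first | rfl | exact absurd rfl hx

theorem reduceOption_block (x : Letter) (e : ℕ) : (block x e).reduceOption = [e] := by
  simp [block, List.reduceOption_append, List.reduceOption_cons_of_some]

theorem replaceSlot_eq_self {s : ℕ} {p : List (Option ℕ)} (h : p.count none ≤ s)
    (b : List (Option ℕ)) : replaceSlot s b p = p := by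
  induction p generalizing s with
  | nil => cases s <;> rfl
  | cons a p ih =>
    cases a with
    | some a =>
      rw [List.count_cons_of_ne (by simp)] at h
      rw [replaceSlot, ih h]
    | none =>
      rw [List.count_cons_self] at h
      obtain ⟨s, rfl⟩ : ∃ k, s = k + 1 := ⟨s - 1, by omega⟩
      rw [replaceSlot, ih (by omega)]

theorem exists_replaceSlot {s : ℕ} {p : List (Option ℕ)} (h : s < p.count none) :
    ∃ A B, p = A ++ none :: B ∧ A.count none = s ∧ ∀ b, replaceSlot s b p = A ++ b ++ B := by
  induction p generalizing s with
  | nil => simp at h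
  | cons a p ih =>
    cases a with
    | some a =>
      rw [List.count_cons_of_ne (by simp)] at h
      obtain ⟨A, B, rfl, hA, hb⟩ := ih h
      exact ⟨some a :: A, B, rfl, by simpa using hA, fun b => by simp [replaceSlot, hb]⟩
    | none =>
      cases s with
      | zero => exact ⟨[], p, rfl, rfl, fun b => rfl⟩
      | succ s =>
        rw [List.count_cons_self] at h
        obtain ⟨A, B, rfl, hA, hb⟩ := ih (s := s) (by omega)
        exact ⟨none :: A, B, rfl, by simp [hA], fun b => by simp [replaceSlot, hb]⟩

/-- Legality is not assumed: the entries also stay the same when the slot asked for does not exist.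
-/
theorem entries_append_singleton (w : List Letter) (x : Letter) :
    entries (w ++ [x]) = entries w ∨ x ≠ .t ∧ ∃ A B, entries w = A ++ B ∧
      entries (w ++ [x]) = A ++ (stateOf w).next :: B := by
  rw [entries, stateOf_append_singleton]
  by_cases hx : x = .t
  · subst hx; exact .inl rfl
  · rw [read_of_ne hx]
    rcases lt_or_ge (stateOf w).slot ((stateOf w).perm.count none) with h | h
    · obtain ⟨A, B, hp, -, hb⟩ := exists_replaceSlot h
      refine .inr ⟨hx, A.reduceOption, B.reduceOption, ?_, ?_⟩
      · rw [entries, hp, List.reduceOption_append, List.reduceOption_cons_of_none]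
      · simp [hb, List.reduceOption_append, reduceOption_block]
    · left
      simp only [replaceSlot_eq_self h]
      rfl

theorem next_append_singleton_le (w : List Letter) (x : Letter) :
    (stateOf w).next ≤ (stateOf (w ++ [x])).next ∧
      (x ≠ .t → (stateOf w).next < (stateOf (w ++ [x])).next) := by
  rw [stateOf_append_singleton]
  cases x <;> simp [BuildState.read]

/-- Later insertions never change the relative order of earlier entries, so this order can be
decided during the scan. -/
theorem entries_sublist_append (u v : List Letter) : (entries u).Sublist (entries (u ++ v)) := by
  induction v using List.reverseRecOn with
  | nil => simp
  | append_singleton v x ih =>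
    refine ih.trans ?_
    rw [← List.append_assoc]
    rcases entries_append_singleton (u ++ v) x with h | ⟨-, A, B, h1, h2⟩
    · rw [h]
    · rw [h1, h2]
      exact (List.Sublist.refl A).append (List.sublist_cons_self _ _)

theorem next_le_append (u v : List Letter) : (stateOf u).next ≤ (stateOf (u ++ v)).next := by
  induction v using List.reverseRecOn with
  | nil => simp
  | append_singleton v x ih =>
    rw [← List.append_assoc]
    exact ih.trans (next_append_singleton_le _ _).1

theorem lt_next_of_mem_entries {w : List Letter} {e : ℕ} (he : e ∈ entries w) :
    e < (stateOf w).next := by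
  induction w using List.reverseRecOn with
  | nil => simp [entries, stateOf, List.reduceOption] at he
  | append_singleton w x ih =>
    obtain ⟨h1, h2⟩ := next_append_singleton_le w x
    rcases entries_append_singleton w x with h | ⟨hx, A, B, h3, h4⟩
    · rw [h] at he; exact (ih he).trans_le h1
    · rw [h4] at he
      rw [h3] at ih
      have : e = (stateOf w).next ∨ e ∈ A ++ B := by simp at he ⊢; tauto
      rcases this with rfl | he
      · exact h2 hx
      · exact (ih he).trans_le h1

theorem nodup_entries (w : List Letter) : (entries w).Nodup := by
  induction w using List.reverseRecOn with
  | nil => simp [entries, stateOf, List.reduceOption]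
  | append_singleton w x ih =>
    rcases entries_append_singleton w x with h | ⟨hx, A, B, h3, h4⟩
    · rwa [h]
    · rw [h4, List.nodup_middle, ← h3, List.nodup_cons]
      exact ⟨fun h => (lt_next_of_mem_entries h).false, ih⟩

theorem exists_of_mem_entries {w : List Letter} {e : ℕ} (he : e ∈ entries w) :
    ∃ u x v, w = u ++ x :: v ∧ x ≠ .t ∧ e = (stateOf u).next := by
  induction w using List.reverseRecOn with
  | nil => simp [entries, stateOf, List.reduceOption] at he
  | append_singleton w x ih =>
    have lift (h : e ∈ entries w) : ∃ u y v, w ++ [x] = u ++ y :: v ∧ y ≠ .t ∧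
        e = (stateOf u).next := by
      obtain ⟨u, y, v, rfl, hy⟩ := ih h
      exact ⟨u, y, v ++ [x], by simp, hy⟩
    rcases entries_append_singleton w x with h | ⟨hx, A, B, h3, h4⟩
    · rw [h] at he; exact lift he
    · rw [h4] at he
      have : e = (stateOf w).next ∨ e ∈ A ++ B := by simp at he ⊢; tauto
      rcases this with rfl | he
      · exact ⟨w, x, [], rfl, hx, rfl⟩
      · exact lift (h3 ▸ he)

/-! ### Legal words and open slots. -/

/-- There is a slot for every letter. This is the first condition on codewords. -/
def Legal (w : List Letter) : Prop :=
  ∀ (u v : List Letter) (x : Letter), w = u ++ x :: v → x ≠ Letter.t →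
    (u.rtakeWhile (fun y => decide (y = Letter.t))).length + u.count Letter.f ≤ u.count Letter.m

theorem slot_stateOf (w : List Letter) :
    (stateOf w).slot = (w.rtakeWhile (fun y => decide (y = Letter.t))).length := by
  induction w using List.reverseRecOn with
  | nil => rfl
  | append_singleton w x ih =>
    rw [stateOf_append_singleton, List.rtakeWhile_concat]
    by_cases hx : x = .t
    · subst hx; simp [BuildState.read, ih]
    · rw [read_of_ne hx]; simp [hx]

theorem legal_nil : Legal [] := by
  intro u v x h; simp at h

theorem legal_append_singleton {w : List Letter} {x : Letter} :
    Legal (w ++ [x]) ↔ Legal w ∧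
      (x ≠ .t → (stateOf w).slot + w.count Letter.f ≤ w.count Letter.m) := by
  rw [slot_stateOf]
  constructor
  · refine fun h => ⟨fun u v y hw hy => h u (v ++ [x]) y (by simp [hw]) hy, h w [] x rfl⟩
  · rintro ⟨h1, h2⟩ u v y hw hy
    rcases List.eq_nil_or_concat v with rfl | ⟨v, z, rfl⟩
    · obtain ⟨rfl, h⟩ := List.append_inj' hw rfl
      obtain rfl := List.singleton_inj.1 h
      exact h2 hy
    · rw [List.concat_eq_append, ← List.cons_append, ← List.append_assoc] at hw
      exact h1 u v y (List.append_inj' hw rfl).1 hy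

theorem Legal.of_append {u v : List Letter} (h : Legal (u ++ v)) : Legal u :=
  fun u' v' x hu hx => h u' (v' ++ v) x (by simp [hu]) hx

/-- There are `#m - #f + 1` open slots, so the bound on the number of letters `t` says precisely
that the slot asked for exists. -/
theorem Legal.count_none {w : List Letter} (h : Legal w) :
    (stateOf w).perm.count none + w.count Letter.f = w.count Letter.m + 1 := by
  induction w using List.reverseRecOn with
  | nil => rfl
  | append_singleton w x ih =>
    obtain ⟨h1, h2⟩ := legal_append_singleton.1 h
    have ih := ih h1
    rw [stateOf_append_singleton]
    by_cases hx : x = .t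
    · subst hx; simpa [BuildState.read, List.count_append] using ih
    · have h2 := h2 hx
      obtain ⟨A, B, hp, -, hb⟩ := exists_replaceSlot
        (show (stateOf w).slot < (stateOf w).perm.count none by omega)
      rw [read_of_ne hx, hb]
      rw [hp] at ih
      cases x <;> simp [block, Letter.leftSlots, Letter.rightSlots, List.count_append] at ih ⊢ <;>
        first | omega | exact absurd rfl hx

/-- In the partly built permutation `p`, the entry `e` has exactly `c` open slots to its left. -/
def SlotsBefore (p : List (Option ℕ)) (e c : ℕ) : Prop :=
  ∃ A B, p = A ++ some e :: B ∧ A.count none = c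

theorem Legal.exists_slot {w : List Letter} {x : Letter} (h : Legal (w ++ [x])) (hx : x ≠ .t) :
    ∃ A B, (stateOf w).perm = A ++ none :: B ∧ A.count none = (stateOf w).slot ∧
      (stateOf (w ++ [x])).perm = A ++ block x (stateOf w).next ++ B := by
  obtain ⟨h1, h2⟩ := legal_append_singleton.1 h
  have h2 := h2 hx
  have h3 := h1.count_none
  obtain ⟨A, B, hp, hA, hb⟩ := exists_replaceSlot
    (show (stateOf w).slot < (stateOf w).perm.count none by omega)
  exact ⟨A, B, hp, hA, by rw [stateOf_append_singleton, read_of_ne hx, hb]⟩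

theorem Legal.slotsBefore_new {w : List Letter} {x : Letter} (h : Legal (w ++ [x]))
    (hx : x ≠ .t) : SlotsBefore (stateOf (w ++ [x])).perm (stateOf w).next
      ((stateOf w).slot + x.leftSlots) := by
  obtain ⟨A, B, -, hA, hp⟩ := h.exists_slot hx
  refine ⟨A ++ List.replicate x.leftSlots none, List.replicate x.rightSlots none ++ B, ?_, ?_⟩
  · rw [hp, block]; simp
  · simp [hA]

theorem Legal.mem_entries {u v : List Letter} {x : Letter} (h : Legal (u ++ x :: v))
    (hx : x ≠ .t) : (stateOf u).next ∈ entries (u ++ x :: v) := by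
  rw [List.append_cons] at h ⊢
  refine (entries_sublist_append _ _).subset ?_
  obtain ⟨A, B, hp, -⟩ := h.of_append.slotsBefore_new hx
  rw [entries, List.reduceOption_mem_iff, hp]
  simp

/-- The slots to the left of an old entry when a letter is read, and the order of the old and the
new entry. -/
theorem Legal.slotsBefore_old {w : List Letter} {x : Letter} (h : Legal (w ++ [x]))
    (hx : x ≠ .t) {e c : ℕ} (hc : SlotsBefore (stateOf w).perm e c) :
    (c ≤ (stateOf w).slot ∧ SlotsBefore (stateOf (w ++ [x])).perm e c ∧
      [e, (stateOf w).next].Sublist (entries (w ++ [x]))) ∨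
    ((stateOf w).slot < c ∧
      SlotsBefore (stateOf (w ++ [x])).perm e (c + x.leftSlots + x.rightSlots - 1) ∧
      [(stateOf w).next, e].Sublist (entries (w ++ [x]))) := by
  obtain ⟨A, B, hAB, hA, hp⟩ := h.exists_slot hx
  obtain ⟨A', B', hAB', hA'⟩ := hc
  rw [entries, hp]
  rw [hAB, List.append_eq_append_iff] at hAB'
  -- The slot being replaced lies to the left of `e` in the first case and to its right in the
  -- second.
  rcases hAB' with ⟨D, rfl, hD⟩ | ⟨D, rfl, hD⟩
  · cases D with
    | nil => simp at hD
    | cons d D =>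
      rw [List.cons_append] at hD
      obtain ⟨rfl, rfl⟩ := List.cons.inj hD
      right
      have hc : c = (stateOf w).slot + 1 + D.count none := by
        rw [← hA', List.count_append, List.count_cons_self, hA]; omega
      refine ⟨by omega, ⟨A ++ block x (stateOf w).next ++ D, B', by simp, ?_⟩, ?_⟩
      · simp [block, hA]; omega
      · simp only [List.reduceOption_append, reduceOption_block,
          List.reduceOption_cons_of_some]
        refine List.Sublist.trans ?_ ((List.sublist_append_right _ _).append_right _)
        simp
  · cases D with
    | nil => simp at hD
    | cons d D =>
      rw [List.cons_append] at hD
      obtain ⟨rfl, rfl⟩ := List.cons.inj hD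
      left
      rw [List.count_append, List.count_cons_of_ne (by simp)] at hA
      refine ⟨by omega, ⟨A', D ++ block x (stateOf w).next ++ B, by simp, hA'⟩, ?_⟩
      simp only [List.reduceOption_append, reduceOption_block,
        List.reduceOption_cons_of_some]
      refine List.Sublist.trans ?_ (List.sublist_append_left _ _)
      refine List.Sublist.append (l₁ := [e]) (l₂ := _) ?_ (List.Sublist.refl _)
      simp

/-! ### Occurrences of the pattern as tuples of positions in the word. -/

/-- The entry that is inserted when the letter at position `p` is read. -/
def entryAt (w : List Letter) (p : ℕ) : ℕ :=
  (stateOf (w.take p)).next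

theorem take_succ_eq {w : List Letter} {p : ℕ} {x : Letter} (hx : w[p]? = some x) :
    w.take (p + 1) = w.take p ++ [x] := by
  rw [List.take_add_one, hx]; rfl

theorem entryAt_lt {w : List Letter} {a b : ℕ} {x : Letter} (ha : w[a]? = some x) (hx : x ≠ .t)
    (hab : a < b) : entryAt w a < entryAt w b := by
  have h1 := (next_append_singleton_le (w.take a) x).2 hx
  rw [← take_succ_eq ha] at h1
  refine h1.trans_le ?_
  have h2 := next_le_append (w.take (a + 1)) ((w.take b).drop (a + 1))
  rwa [show w.take (a + 1) = (w.take b).take (a + 1) by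
    rw [List.take_take, min_eq_left (by omega)], List.take_append_drop, List.take_take,
    min_eq_left (by omega)] at h2

theorem entryAt_lt_iff {w : List Letter} {a b : ℕ} {x y : Letter} (ha : w[a]? = some x)
    (hx : x ≠ .t) (hb : w[b]? = some y) (hy : y ≠ .t) : entryAt w a < entryAt w b ↔ a < b := by
  refine ⟨fun h => ?_, entryAt_lt ha hx⟩
  by_contra! hle
  rcases hle.lt_or_eq with hlt | rfl
  · exact (entryAt_lt hb hy hlt).not_gt h
  · exact h.false

theorem Legal.entryAt_mem {w : List Letter} (h : Legal w) {p : ℕ} {x : Letter}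
    (hp : w[p]? = some x) (hx : x ≠ .t) : entryAt w p ∈ entries w := by
  obtain ⟨hlt, rfl⟩ := List.getElem?_eq_some_iff.1 hp
  have hw : w = w.take p ++ w[p] :: w.drop (p + 1) := by
    rw [← List.drop_eq_getElem_cons hlt, List.take_append_drop]
  generalize w[p] = x at hw hx
  rw [hw] at h
  have := h.mem_entries hx
  rwa [← hw] at this

theorem exists_entryAt {w : List Letter} {e : ℕ} (he : e ∈ entries w) :
    ∃ p x, w[p]? = some x ∧ x ≠ .t ∧ entryAt w p = e := by
  obtain ⟨u, x, v, rfl, hx, rfl⟩ := exists_of_mem_entries he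
  exact ⟨u.length, x, by simp, hx, by simp [entryAt]⟩

/-- The entries inserted at the positions `a i` of the word form a copy of the pattern. -/
def IsOccurrence (w : List Letter) (q : List ℝ) (a : Fin q.length → ℕ) : Prop :=
  (∀ i, ∃ x, w[a i]? = some x ∧ x ≠ .t) ∧
  (∀ i j, i < j → a i ≠ a j ∧ (a i < a j ↔ q[i] < q[j])) ∧
  -- Each pair is listed with the earlier insertion first, because its order is tested when the
  -- later entry is inserted.
  ∀ i j, a i < a j → ([entryAt w (a i), entryAt w (a j)].Sublist (entries w) ↔ i < j)

theorem Legal.sublist_or {w : List Letter} (h : Legal w) {a b : ℕ} {x y : Letter}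
    (ha : w[a]? = some x) (hx : x ≠ .t) (hb : w[b]? = some y) (hy : y ≠ .t) (hab : a ≠ b) :
    [entryAt w a, entryAt w b].Sublist (entries w) ∨
      [entryAt w b, entryAt w a].Sublist (entries w) := by
  have hne : entryAt w a ≠ entryAt w b := fun he => by
    rcases lt_or_gt_of_ne hab with h | h
    · exact (entryAt_lt ha hx h).ne he
    · exact (entryAt_lt hb hy h).ne' he
  obtain ⟨l₁, l₂, hl⟩ := List.append_of_mem (h.entryAt_mem ha hx)
  have hm := h.entryAt_mem hb hy
  rw [hl] at hm ⊢
  rcases List.mem_append.1 hm with hm | hm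
  · right
    exact (List.singleton_sublist.2 hm).append (List.singleton_sublist.2 (by simp))
  · left
    have hm := (List.mem_cons.1 hm).resolve_left hne.symm
    exact ((List.singleton_sublist.2 hm).cons_cons _).trans (List.sublist_append_right _ _)

theorem Legal.contains_iff {w : List Letter} (h : Legal w) (q : List ℝ) :
    PatternPerm.Contains (decode w) q ↔ ∃ a, IsOccurrence w q a := by
  have hnd := nodup_entries w
  rw [decode_eq_entries]
  constructor
  · rintro ⟨s, hs, hlen, hiso⟩
    have hmem (i : Fin q.length) : s[i] ∈ entries w := hs.subset (List.getElem_mem _)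
    choose a x ha hx hax using fun i => exists_entryAt (hmem i)
    have hpair {i j : Fin q.length} (hij : i < j) :
        [entryAt w (a i), entryAt w (a j)].Sublist (entries w) := by
      rw [hax, hax]
      refine List.Sublist.trans ?_ hs
      have hs : s.Pairwise fun a b => [a, b].Sublist s :=
        List.pairwise_iff_forall_sublist.2 fun h => h
      exact List.pairwise_iff_getElem.1 hs i j (by omega) (by omega) hij
    refine ⟨a, fun i => ⟨x i, ha i, hx i⟩, fun i j hij => ⟨fun he => ?_, ?_⟩, fun i j hlt => ?_⟩
    · have := (hpair hij)
      rw [he] at this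
      exact hnd.not_sublist_swap this this
    · have := hiso i j hij (by omega)
      rw [← entryAt_lt_iff (ha i) (hx i) (ha j) (hx j), hax, hax]
      exact this
    · refine ⟨fun hsub => ?_, hpair⟩
      by_contra! hle
      rcases hle.lt_or_eq with hji | rfl
      · exact hnd.not_sublist_swap hsub (hpair hji)
      · exact hlt.false
  · rintro ⟨a, ha, hq, hord⟩
    choose x hx hxt using ha
    have hpair {i j : Fin q.length} (hij : i < j) :
        [entryAt w (a i), entryAt w (a j)].Sublist (entries w) := by
      -- If entry `j` was inserted first, the condition for `(j, i)` only excludes the wrong order;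
      -- the right one follows by totality.
      rcases lt_or_gt_of_ne (hq i j hij).1 with hlt | hlt
      · exact (hord i j hlt).2 hij
      · refine (h.sublist_or (hx i) (hxt i) (hx j) (hxt j) hlt.ne').resolve_right fun hs => ?_
        exact ((hord j i hlt).1 hs).not_gt hij
    refine ⟨List.ofFn fun i => entryAt w (a i), hnd.sublist_of_pairwise ?_ ?_, by simp, ?_⟩
    · intro e he
      obtain ⟨i, rfl⟩ := List.mem_ofFn.1 he
      exact h.entryAt_mem (hx i) (hxt i)
    · rw [List.pairwise_ofFn]
      exact fun i j hij => hpair hij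
    · intro i j hij hj
      rw [List.length_ofFn] at hj
      simp only [List.getElem_ofFn]
      rw [entryAt_lt_iff (hx _) (hxt _) (hx _) (hxt _)]
      exact (hq ⟨i, hij.trans hj⟩ ⟨j, hj⟩ hij).2

end ItEncoding

/-! ### Counting through tuples -/

/-- The value of a tuple, read as a number in base `n + 1`. -/
def tupleValue (n : ℕ) {k : ℕ} (a : Fin k → ℕ) : ℕ :=
  ∑ i, a i * (n + 1) ^ (i : ℕ)

/-- The next tuple. -/
def nextTuple (n : ℕ) {k : ℕ} (a : Fin k → ℕ) (i : Fin k) : ℕ :=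
  -- Add one with carry, where coordinate `0` is the least significant digit.
  if ∀ j < i, a j = n then if a i = n then 0 else a i + 1 else a i

theorem tupleValue_succ (n : ℕ) {k : ℕ} (a : Fin (k + 1) → ℕ) :
    tupleValue n a = a 0 + (n + 1) * tupleValue n (fun i => a i.succ) := by
  simp only [tupleValue, Fin.sum_univ_succ, Finset.mul_sum, Fin.val_zero, pow_zero, mul_one,
    Fin.val_succ, pow_succ]
  congr 1
  exact Finset.sum_congr rfl fun i _ => by ring

theorem tupleValue_lt {n k : ℕ} {a : Fin k → ℕ} (ha : ∀ i, a i ≤ n) :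
    tupleValue n a < (n + 1) ^ k := by
  induction k with
  | zero => simp [tupleValue]
  | succ k ih =>
    rw [tupleValue_succ, pow_succ]
    have h0 := ha 0
    have h1 := ih fun i => ha (Fin.succ i)
    nlinarith

theorem tupleValue_injOn {n k : ℕ} {a b : Fin k → ℕ} (ha : ∀ i, a i ≤ n) (hb : ∀ i, b i ≤ n)
    (h : tupleValue n a = tupleValue n b) : a = b := by
  induction k with
  | zero => exact Subsingleton.elim _ _
  | succ k ih =>
    rw [tupleValue_succ, tupleValue_succ] at h
    have h0 := congrArg (· % (n + 1)) h
    simp only [Nat.add_mul_mod_self_left, Nat.mod_eq_of_lt (Nat.lt_succ_of_le (ha 0)),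
      Nat.mod_eq_of_lt (Nat.lt_succ_of_le (hb 0))] at h0
    rw [h0] at h
    have h1 := ih (fun i => ha (Fin.succ i)) (fun i => hb (Fin.succ i))
      (Nat.eq_of_mul_eq_mul_left n.succ_pos (Nat.add_left_cancel h))
    funext i
    refine Fin.cases h0 (fun i => congrFun h1 i) i

theorem tupleValue_mono {n k : ℕ} {a b : Fin k → ℕ} (h : ∀ i, a i ≤ b i) :
    tupleValue n a ≤ tupleValue n b :=
  Finset.sum_le_sum fun i _ => Nat.mul_le_mul_right _ (h i)

theorem nextTuple_le {n k : ℕ} {a : Fin k → ℕ} (ha : ∀ i, a i ≤ n) (i : Fin k) :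
    nextTuple n a i ≤ n := by
  have := ha i
  unfold nextTuple
  split_ifs <;> omega

theorem tupleValue_nextTuple {n k : ℕ} {a : Fin k → ℕ} (h : ∃ i, a i ≠ n) :
    tupleValue n (nextTuple n a) = tupleValue n a + 1 := by
  induction k with
  | zero => obtain ⟨i, -⟩ := h; exact i.elim0
  | succ k ih =>
    rw [tupleValue_succ, tupleValue_succ]
    by_cases h0 : a 0 = n
    · have h1 : (fun i : Fin k => nextTuple n a i.succ) = nextTuple n fun i => a i.succ := by
        funext i
        simp only [nextTuple, Fin.forall_fin_succ, h0, Fin.succ_lt_succ_iff]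
        simp
      have h2 : nextTuple n a 0 = 0 := by simp [nextTuple, h0]
      rw [h1, h2, ih]
      · rw [h0]; ring
      · obtain ⟨i, hi⟩ := h
        refine ⟨i.pred (by rintro rfl; exact hi h0), by simpa using hi⟩
    · have h1 : (fun i : Fin k => nextTuple n a i.succ) = fun i => a i.succ := by
        funext i
        simp [nextTuple, Fin.forall_fin_succ, h0]
      have h2 : nextTuple n a 0 = a 0 + 1 := by simp [nextTuple, h0]
      rw [h1, h2]
      ring

/-! ### The algorithm -/

namespace ItEncoding

/-- The counters of the algorithm for patterns of length `k`: the position in the word, the number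
of letters `m` and `f` that have been read, the number of letters `f` plus the number of letters
`t` just read, and for every `i` the chosen position `idx i`. The difference of `up i` and
`down i` is the number of open slots to the left of the entry inserted at this position, and
`shift i` exceeds `down i` by the number of letters `t` just read. -/
inductive Ctr (k : ℕ) where
  | pos
  | numM
  | numF
  | fill
  | idx (i : Fin k)
  | up (i : Fin k)
  | down (i : Fin k)
  | shift (i : Fin k)

instance (k : ℕ) : Finite (Ctr k) :=
  Finite.of_surjective
    (fun x : Fin 4 ⊕ Fin k ⊕ Fin k ⊕ Fin k ⊕ Fin k => match x with
      | .inl 0 => Ctr.pos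
      | .inl 1 => .numM
      | .inl 2 => .numF
      | .inl 3 => .fill
      | .inr (.inl i) => .idx i
      | .inr (.inr (.inl i)) => .up i
      | .inr (.inr (.inr (.inl i))) => .down i
      | .inr (.inr (.inr (.inr i))) => .shift i)
    (fun c => match c with
      | .pos => ⟨.inl 0, rfl⟩
      | .numM => ⟨.inl 1, rfl⟩
      | .numF => ⟨.inl 2, rfl⟩
      | .fill => ⟨.inl 3, rfl⟩
      | .idx i => ⟨.inr (.inl i), rfl⟩
      | .up i => ⟨.inr (.inr (.inl i)), rfl⟩
      | .down i => ⟨.inr (.inr (.inr (.inl i))), rfl⟩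
      | .shift i => ⟨.inr (.inr (.inr (.inr i))), rfl⟩)

section algorithm

open Classical

variable {k : ℕ}

/-- The assignments when the letter `x` is read. -/
noncomputable def scanOps (x : Letter) (le : Ctr k → Ctr k → Prop) :
    Ctr k → Option (Ctr k × Bool)
  | .pos => some (.pos, true)
  | .numM => some (.numM, decide (x = .m))
  | .numF => some (.numF, decide (x = .f))
  -- Any letter other than `t` ends the run of letters `t`, so `fill` falls back to the new value of
  -- `numF`.
  | .fill => if x = .t then some (.fill, true) else some (.numF, decide (x = .f))
  | .idx i => some (.idx i, false)
  | .up i =>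
    -- The chosen entry is inserted now. Up to here `up i` and `down i` are `0`, so `shift i` is the
    -- index of the slot, and the slot left open to the left of the entry is added.
    if x ≠ .t ∧ le .pos (.idx i) ∧ le (.idx i) .pos then
      some (.shift i, decide (x.leftSlots = 1))
    else some (.up i, decide (x = .m ∧ ¬ le (.up i) (.shift i)))
  -- Counters cannot be decremented, so the loss of a slot is recorded as an increment of `down i`.
  | .down i => some (.down i, decide (x = .f ∧ ¬ le (.up i) (.shift i)))
  | .shift i =>
    if x = .t then some (.shift i, true)
    else some (.down i, decide (x = .f ∧ ¬ le (.up i) (.shift i)))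

/-- If the letter `x` inserts a chosen entry, then its order relative to the chosen entries that
have been inserted before is as in the pattern. -/
def Consistent (x : Letter) (le : Ctr k → Ctr k → Prop) : Prop :=
  x ≠ .t → ∀ i j, le .pos (.idx j) → le (.idx j) .pos → ¬ le .pos (.idx i) →
    -- Subtracting `down i` turns `up i ≤ shift i` into `c ≤ j₀`, where entry `i` has `c` slots to
    -- its left and `j₀` letters `t` were just read: the new entry goes to the right of entry `i`.
    (le (.up i) (.shift i) ↔ i < j)

/-- The chosen positions are positions of entries and are ordered like the entries of the
pattern. -/
def Arranged (q : List ℝ) (letter : Ctr q.length → Option Letter)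
    (le : Ctr q.length → Ctr q.length → Prop) : Prop :=
  (∀ i, ∃ x, letter (.idx i) = some x ∧ x ≠ .t) ∧
  ∀ i j, i < j → ¬ (le (.idx i) (.idx j) ∧ le (.idx j) (.idx i)) ∧
    (¬ le (.idx j) (.idx i) ↔ q[i] < q[j])

/-- The assignments that pass to the next choice of positions. -/
noncomputable def advanceOps (letter : Ctr k → Option Letter) : Ctr k → Option (Ctr k × Bool)
  | .idx i =>
    -- A counter equals `n` exactly when it reads no letter, so this is `nextTuple`; all other
    -- counters return to `0` for a new scan.
    if ∀ j < i, letter (.idx j) = none then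
      if letter (.idx i) = none then none else some (.idx i, true)
    else some (.idx i, false)
  | _ => none

/-- The counter automaton that decides whether a word is a codeword of a permutation that avoids
`q`: for all choices of positions it scans the word and compares the chosen entries with the
pattern. -/
noncomputable def automaton (q : List ℝ) : CounterAutomaton Letter where
  State := Bool
  Ctr := Ctr q.length
  finite_state := inferInstance
  finite_ctr := inferInstance
  start := true
  next ok letter le :=
    match letter .pos with
    | some x =>
      -- Since `fill` is the number of letters `t` just read plus the number of letters `f`, this is
      -- a violation of the first condition on codewords.
      if x ≠ .t ∧ ¬ le .fill .numM then .inl false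
      else .inr (decide (ok = true ∧ Consistent x le), scanOps x le)
    | none =>
      if le .numF .numM ∨ ¬ le .fill .numF then .inl false
      else if ok = true ∧ Arranged q letter le then .inl false
      -- All positions stand at the end marker, so the last tuple has been tried without finding a
      -- copy.
      else if ∀ i, letter (.idx i) = none then .inl true
      else .inr (true, advanceOps letter)

end algorithm

/-! ### Correctness of a single scan. -/

variable {q : List ℝ}

/-- What holds for the counters after reading the first `p` letters, if the positions `a` have
been chosen. -/
structure ScanInv (w : List Letter) (a : Fin q.length → ℕ) (p : ℕ) (ok : Bool)
    (v : Ctr q.length → ℕ) : Prop where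
  legal : Legal (w.take p)
  pos : v .pos = p
  numM : v .numM = (w.take p).count .m
  numF : v .numF = (w.take p).count .f
  fill : v .fill = (stateOf (w.take p)).slot + (w.take p).count .f
  fill_le : v .fill ≤ p
  idx : ∀ i, v (.idx i) = a i
  up_le : ∀ i, v (.up i) ≤ p
  shift_le : ∀ i, v (.shift i) ≤ p
  shift : ∀ i, v (.shift i) = v (.down i) + (stateOf (w.take p)).slot
  before : ∀ i, p ≤ a i → v (.up i) = 0 ∧ v (.down i) = 0
  after : ∀ i, a i < p → w[a i]? ≠ some .t → ∃ c, v (.up i) = v (.down i) + c ∧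
    SlotsBefore (stateOf (w.take p)).perm (entryAt w (a i)) c
  -- If a chosen letter is `t`, the flag may be meaningless, because `Arranged` fails at the end
  -- anyway.
  ok_iff : (∀ i, w[a i]? ≠ some .t) → (ok = true ↔ ∀ i j, a i < a j → a j < p →
    ([entryAt w (a i), entryAt w (a j)].Sublist (entries w) ↔ i < j))

theorem ScanInv.init (w : List Letter) (a : Fin q.length → ℕ) {v : Ctr q.length → ℕ}
    (hi : ∀ i, v (.idx i) = a i) (h0 : ∀ c, (∀ i, c ≠ .idx i) → v c = 0) :
    ScanInv w a 0 true v where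
  legal := by simpa using legal_nil
  pos := h0 _ (by simp)
  numM := by simpa using h0 .numM (by simp)
  numF := by simpa using h0 .numF (by simp)
  fill := by simpa [stateOf] using h0 .fill (by simp)
  fill_le := (h0 _ (by simp)).le
  idx := hi
  up_le i := (h0 _ (by simp)).le
  shift_le i := (h0 _ (by simp)).le
  shift i := by simp [stateOf, h0]
  before i _ := ⟨h0 _ (by simp), h0 _ (by simp)⟩
  after i h := absurd h (Nat.not_lt_zero _)
  ok_iff _ := by simp

theorem assign_of_lt {n : ℕ} {v : Ctr q.length → ℕ} {d : Ctr q.length} (b : Bool) (h : v d < n) :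
    CounterAutomaton.assign n v (some (d, b)) = v d + b.toNat := by
  cases b
  · rfl
  · exact min_eq_left h

/-- The counters follow `Legal.slotsBefore_new` and `Legal.slotsBefore_old`. The first violation of
legality already refutes the word, since legality passes to prefixes. -/
theorem step_scan {w : List Letter} {a : Fin q.length → ℕ} {p : ℕ} {ok : Bool}
    {v : Ctr q.length → ℕ} (h : ScanInv w a p ok v) (hp : p < w.length) :
    (automaton q).step w (ok, v) = .inl false ∧ ¬ IsCodeword w ∨
    ∃ ok' v', (automaton q).step w (ok, v) = .inr (ok', v') ∧ ScanInv w a (p + 1) ok' v' := by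
  classical
  have hx := List.getElem?_eq_getElem hp
  generalize w[p] = x at hx
  have htake := take_succ_eq hx
  have hstep : (automaton q).step w (ok, v) =
      if x ≠ .t ∧ ¬ v .fill ≤ v .numM then .inl false
      else .inr (decide (ok = true ∧ Consistent x fun c d => v c ≤ v d),
        fun c => CounterAutomaton.assign w.length v (scanOps x (fun c d => v c ≤ v d) c)) := by
    simp only [CounterAutomaton.step, automaton, h.pos, hx]
    split_ifs <;> rfl
  rw [hstep]
  have hlegal : Legal (w.take (p + 1)) ↔ ¬ (x ≠ .t ∧ ¬ v .fill ≤ v .numM) := by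
    rw [htake, legal_append_singleton, h.fill, h.numM]
    have := h.legal
    tauto
  split_ifs with hc
  · refine .inl ⟨rfl, fun hw => ?_⟩
    have hw : Legal w := hw.1
    rw [← List.take_append_drop (p + 1) w] at hw
    exact hlegal.1 hw.of_append hc
  right
  have hl := hlegal.2 hc
  obtain ⟨v', hv'⟩ : ∃ v' : Ctr q.length → ℕ, v' = fun c =>
    CounterAutomaton.assign w.length v (scanOps x (fun c d => v c ≤ v d) c) := ⟨_, rfl⟩
  refine ⟨_, v', congrArg (fun z => Sum.inr (_, z)) hv'.symm, ?_⟩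
  have hnM : v .numM ≤ p := by
    rw [h.numM]; exact List.count_le_length.trans (List.length_take_le _ _)
  have hnF : v .numF ≤ v .fill := by rw [h.numF, h.fill]; omega
  have hfill := h.fill_le
  have hdown (i) : v (.down i) ≤ p := by have := h.shift i; have := h.shift_le i; omega
  have epos : v' .pos = p + 1 := by
    rw [← h.pos] at hp ⊢; rw [hv']; exact assign_of_lt _ hp
  have enumM : v' .numM = v .numM + (decide (x = .m)).toNat := by
    rw [hv']; exact (assign_of_lt _ (by omega)).trans (by congr!)
  have enumF : v' .numF = v .numF + (decide (x = .f)).toNat := by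
    rw [hv']; exact (assign_of_lt _ (by omega)).trans (by congr!)
  have efill : v' .fill = if x = .t then v .fill + 1 else v .numF + (decide (x = .f)).toNat := by
    simp only [hv', scanOps]
    split_ifs <;> exact (assign_of_lt _ (by omega)).trans (by congr!)
  have eidx (i) : v' (.idx i) = a i := by rw [hv']; exact h.idx i
  have eup (i) : v' (.up i) = if x ≠ .t ∧ a i = p then
      v (.shift i) + (decide (x.leftSlots = 1)).toNat
      else v (.up i) + (decide (x = .m ∧ ¬ v (.up i) ≤ v (.shift i))).toNat := by
    have h1 := h.up_le i
    have h2 := h.shift_le i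
    simp only [hv', scanOps, h.pos, h.idx, show p ≤ a i ∧ a i ≤ p ↔ a i = p by omega]
    split_ifs <;> exact (assign_of_lt _ (by omega)).trans (by congr!)
  have edown (i) : v' (.down i) =
      v (.down i) + (decide (x = .f ∧ ¬ v (.up i) ≤ v (.shift i))).toNat := by
    rw [hv']; exact (assign_of_lt _ ((hdown i).trans_lt hp)).trans (by congr!)
  have eshift (i) : v' (.shift i) = if x = .t then v (.shift i) + 1
      else v (.down i) + (decide (x = .f ∧ ¬ v (.up i) ≤ v (.shift i))).toNat := by
    have h1 := hdown i
    have h2 := h.shift_le i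
    simp only [hv', scanOps]
    split_ifs <;> exact (assign_of_lt _ (by omega)).trans (by congr!)
  clear hv'
  have hstate := stateOf_append_singleton (w.take p) x
  rw [← htake] at hstate
  by_cases ht : x = .t
  · subst ht
    simp only [BuildState.read] at hstate
    have hne {i} (hi : w[a i]? ≠ some .t) : a i ≠ p := by rintro he; rw [he] at hi; exact hi hx
    simp only [reduceCtorEq, false_and, ne_eq, not_true_eq_false, decide_false, Bool.toNat_false,
      add_zero, if_true, if_false] at enumM enumF efill eup edown eshift
    refine ⟨hl, epos, ?_, ?_, ?_, ?_, eidx, ?_, ?_, ?_, ?_, ?_, ?_⟩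
    · rw [enumM, h.numM, htake, List.count_append]; rfl
    · rw [enumF, h.numF, htake, List.count_append]; rfl
    · rw [efill, h.fill, hstate, htake, List.count_append, List.count_singleton]
      simp only [reduceCtorEq, beq_iff_eq, if_false]
      omega
    · omega
    · intro i; have := h.up_le i; have := eup i; omega
    · intro i; have := h.shift_le i; have := eshift i; omega
    · intro i; have := h.shift i; have := eshift i; have := edown i; rw [hstate]; dsimp only; omega
    · intro i hi; have := h.before i (by omega); rw [eup, edown]; exact this
    · intro i hi hit
      have := hne hit
      rw [hstate, eup, edown]
      exact h.after i (by omega) hit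
    · intro hnt
      rw [decide_eq_true_iff, h.ok_iff hnt]
      refine ⟨fun h1 i j hij hj => h1.1 i j hij ?_, fun h1 => ⟨fun i j hij hj => ?_, ?_⟩⟩
      · have := hne (hnt j); omega
      · exact h1 i j hij (by omega)
      · exact fun h => absurd rfl h
  · rw [read_of_ne ht] at hstate
    rw [htake] at hl
    have hsub : (entries (w.take p ++ [x])).Sublist (entries w) := by
      rw [← htake]
      have := entries_sublist_append (w.take (p + 1)) (w.drop (p + 1))
      rwa [List.take_append_drop] at this
    -- For a chosen entry already present: its new slot count, and the side on which the new entry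
    -- lands.
    have hold {i} (hi : a i < p) (hit : w[a i]? ≠ some .t) :
        ∃ c, v (.up i) = v (.down i) + c ∧ 
          ((c ≤ (stateOf (w.take p)).slot ∧
            SlotsBefore (stateOf (w.take (p + 1))).perm (entryAt w (a i)) c ∧
            [entryAt w (a i), entryAt w p].Sublist (entries w)) ∨
          ((stateOf (w.take p)).slot < c ∧
            SlotsBefore (stateOf (w.take (p + 1))).perm (entryAt w (a i))
              (c + x.leftSlots + x.rightSlots - 1) ∧
            [entryAt w p, entryAt w (a i)].Sublist (entries w))) := by
      obtain ⟨c, hc, hs⟩ := h.after i hi hit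
      refine ⟨c, hc, ?_⟩
      rw [htake]
      rcases hl.slotsBefore_old ht hs with ⟨h1, h2, h3⟩ | ⟨h1, h2, h3⟩
      · exact .inl ⟨h1, h2, h3.trans hsub⟩
      · exact .inr ⟨h1, h2, h3.trans hsub⟩
    have hleft : x.leftSlots = (decide (x.leftSlots = 1)).toNat := by
      cases x <;> rfl
    have hbool (b : Bool) : b.toNat ≤ 1 := b.toNat_le
    simp only [ht, if_false, ne_eq, not_false_eq_true, true_and] at efill eup eshift
    have hmono (i) : v' (.down i) ≤ p + 1 := by
      have := hdown i; have := edown i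
      have := hbool (decide (x = .f ∧ ¬ v (.up i) ≤ v (.shift i))); omega
    have hs' (i) : v' (.shift i) = v' (.down i) := by rw [eshift, edown]
    refine ⟨by rwa [htake], epos, ?_, ?_, ?_, ?_, eidx, ?_, ?_, ?_, ?_, ?_, ?_⟩
    · rw [enumM, h.numM, htake, List.count_append]; cases x <;> rfl
    · rw [enumF, h.numF, htake, List.count_append]; cases x <;> rfl
    · rw [efill, h.numF, hstate, htake, List.count_append, zero_add]; cases x <;> rfl
    · have := hbool (decide (x = .f)); omega
    · intro i
      have h1 := h.up_le i
      have h2 := h.shift_le i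
      rw [eup]
      split_ifs
      · have := hbool (decide (x.leftSlots = 1)); omega
      · have := hbool (decide (x = .m ∧ ¬ v (.up i) ≤ v (.shift i))); omega
    · intro i; rw [hs']; exact hmono i
    · intro i; rw [hs', hstate]; rfl
    · intro i hi
      obtain ⟨h1, h2⟩ := h.before i (by omega)
      rw [eup, edown, if_neg (by omega), h1, h2]
      simp
    · intro i hi hit
      rcases (Nat.lt_succ_iff.1 hi).lt_or_eq with hlt | heq
      · obtain ⟨c, hc, h1⟩ := hold hlt hit
        have hsh := h.shift i
        rw [eup, edown, if_neg hlt.ne]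
        rcases h1 with ⟨h1, h2, -⟩ | ⟨h1, h2, -⟩
        · refine ⟨c, ?_, h2⟩
          have : v (.up i) ≤ v (.shift i) := by omega
          simp only [this, not_true_eq_false, and_false, decide_false, Bool.toNat_false, add_zero]
          exact hc
        · refine ⟨_, ?_, h2⟩
          have : ¬ v (.up i) ≤ v (.shift i) := by omega
          cases x <;> first
            | exact absurd rfl ht
            | (simp [this, Letter.leftSlots, Letter.rightSlots]; omega)
      · obtain ⟨h1, h2⟩ := h.before i heq.ge
        have hsh := h.shift i
        refine ⟨(stateOf (w.take p)).slot + x.leftSlots, ?_, ?_⟩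
        · rw [eup, edown, if_pos heq, h1, h2, ← hleft]
          simp
          omega
        · rw [heq, htake]
          exact hl.slotsBefore_new ht
    · intro hnt
      rw [decide_eq_true_iff, h.ok_iff hnt]
      -- The counter test agrees with the order in the final permutation, since later letters
      -- preserve it.
      have key {i} (hi : a i < p) : v (.up i) ≤ v (.shift i) ↔
          [entryAt w (a i), entryAt w p].Sublist (entries w) := by
        have hsh := h.shift i
        obtain ⟨c, hc, ⟨h1, -, h2⟩ | ⟨h1, -, h2⟩⟩ := hold hi (hnt i)
        · exact iff_of_true (by omega) h2
        · exact iff_of_false (by omega) fun h3 => (nodup_entries w).not_sublist_swap h2 h3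
      have hcons : Consistent x (fun c d => v c ≤ v d) ↔ ∀ i j, a j = p → a i < p →
          ([entryAt w (a i), entryAt w (a j)].Sublist (entries w) ↔ i < j) := by
        simp only [Consistent, h.pos, h.idx]
        refine ⟨fun h1 i j hj hi => ?_, fun h1 _ i j hj hj' hi => ?_⟩
        · rw [hj, ← key hi]; exact h1 ht i j hj.ge hj.le (by omega)
        · have hj : a j = p := by omega
          have := h1 i j hj (by omega)
          rwa [hj, ← key (by omega)] at this
      rw [hcons]
      refine ⟨fun h1 i j hij hj => ?_, fun h1 => ⟨fun i j hij hj => ?_, fun i j hj hi => ?_⟩⟩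
      · rcases (Nat.lt_succ_iff.1 hj).lt_or_eq with hlt | heq
        · exact h1.1 i j hij hlt
        · exact h1.2 i j heq (by omega)
      · exact h1 i j hij (by omega)
      · exact h1 i j (by omega) (by omega)

/-- The second conjunct says that `w` does not end with `t`. Legality at a last letter other than
`t` gives `#f ≤ #m` before it, so `#m < #f` forces this letter to be `f` and the difference to be
one. -/
theorem Legal.isCodeword_iff {w : List Letter} (h : Legal w) :
    IsCodeword w ↔ w.count .m < w.count .f ∧ (stateOf w).slot + w.count .f ≤ w.count .f := by
  rcases List.eq_nil_or_concat w with rfl | ⟨u, x, rfl⟩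
  · simp [IsCodeword]
  · rw [List.concat_eq_append] at h ⊢
    obtain ⟨-, h1⟩ := legal_append_singleton.1 h
    rw [stateOf_append_singleton]
    change Legal (u ++ [x]) ∧ _ ↔ _
    rw [and_iff_right h]
    cases x <;>
      simp [BuildState.read, List.count_append] at h1 ⊢ <;> omega

theorem step_end {w : List Letter} {a : Fin q.length → ℕ} {ok : Bool} {v : Ctr q.length → ℕ}
    (h : ScanInv w a w.length ok v) (ha : ∀ i, a i ≤ w.length) :
    (automaton q).step w (ok, v) = .inl false ∧ ¬ (IsCodeword w ∧ ¬ IsOccurrence w q a) ∨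
    (IsCodeword w ∧ ¬ IsOccurrence w q a) ∧
      ((automaton q).step w (ok, v) = .inl true ∧ (∀ i, a i = w.length) ∨
      (∃ i, a i ≠ w.length) ∧ ∃ v', (automaton q).step w (ok, v) = .inr (true, v') ∧
        ScanInv w (nextTuple w.length a) 0 true v') := by
  classical
  have hstep : (automaton q).step w (ok, v) =
      if v .numF ≤ v .numM ∨ ¬ v .fill ≤ v .numF then .inl false
      else if ok = true ∧ Arranged q (fun c => w[v c]?) (fun c d => v c ≤ v d) then .inl false
      else if ∀ i, w[a i]? = none then .inl true
      else .inr (true, fun c => CounterAutomaton.assign w.length v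
        (advanceOps (fun c => w[v c]?) c)) := by
    simp only [CounterAutomaton.step, automaton, h.pos, h.idx, List.getElem?_eq_none le_rfl]
    split_ifs <;> rfl
  have hlegal : Legal w := by simpa using h.legal
  have hnumM := h.numM
  have hnumF := h.numF
  have hfill := h.fill
  rw [List.take_length] at hnumM hnumF hfill
  have hcode : IsCodeword w ↔ ¬ (v .numF ≤ v .numM ∨ ¬ v .fill ≤ v .numF) := by
    rw [hlegal.isCodeword_iff, hnumM, hnumF, hfill]
    omega
  have hnone (i) : w[a i]? = none ↔ a i = w.length := by
    rw [List.getElem?_eq_none_iff]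
    have := ha i
    omega
  have hocc : IsOccurrence w q a ↔
      ok = true ∧ Arranged q (fun c => w[v c]?) (fun c d => v c ≤ v d) := by
    have harr : Arranged q (fun c => w[v c]?) (fun c d => v c ≤ v d) ↔
        (∀ i, ∃ x, w[a i]? = some x ∧ x ≠ .t) ∧
          ∀ i j, i < j → a i ≠ a j ∧ (a i < a j ↔ q[i] < q[j]) := by
      simp only [Arranged, h.idx, not_le]
      refine and_congr_right fun _ => forall₃_congr fun i j _ => and_congr_left fun _ => ?_
      omega
    rw [harr, IsOccurrence]
    refine ⟨fun ⟨h1, h2, h3⟩ => ⟨(h.ok_iff fun i => ?_).2 fun i j hij _ => h3 i j hij, h1, h2⟩,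
      fun ⟨h1, h2, h3⟩ => ⟨h2, h3, fun i j hij => (h.ok_iff fun i => ?_).1 h1 i j hij ?_⟩⟩
    · obtain ⟨x, hx, hxt⟩ := h1 i
      rw [hx]
      exact fun he => hxt (Option.some.inj he)
    · obtain ⟨x, hx, hxt⟩ := h2 i
      rw [hx]
      exact fun he => hxt (Option.some.inj he)
    · obtain ⟨x, hx, -⟩ := h2 j
      exact (List.getElem?_eq_some_iff.1 hx).1
  rw [hstep, hcode, hocc]
  split_ifs with h1 h2 h3
  · exact .inl ⟨rfl, fun h => h.1 h1⟩
  · exact .inl ⟨rfl, fun h => h.2 h2⟩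
  · exact .inr ⟨⟨h1, h2⟩, .inl ⟨rfl, fun i => (hnone i).1 (h3 i)⟩⟩
  -- Some coordinate is below `n`, so the next tuple starts a new scan with the other counters at
  -- `0`.
  · obtain ⟨i, hi⟩ := not_forall.1 h3
    refine .inr ⟨⟨h1, h2⟩, .inr ⟨⟨i, fun he => hi ((hnone i).2 he)⟩, _, rfl,
      ScanInv.init _ _ (fun i => ?_) fun c hc => ?_⟩⟩
    · simp only [advanceOps, h.idx, hnone, nextTuple]
      split_ifs with h4 h5
      · rfl
      · exact (assign_of_lt _ (by have := ha i; rw [h.idx]; omega)).trans (by rw [h.idx]; rfl)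
      · exact h.idx i
    · cases c <;> first | rfl | exact absurd rfl (hc _)

/-! ### Running through all tuples of positions. -/

/-- A scan from an intermediate position to the end. The last hypothesis describes the scan for
the next choice of positions. -/
theorem haltsIn_scan {w : List Letter} {a : Fin q.length → ℕ} (ha : ∀ i, a i ≤ w.length)
    {K : ℕ} {r : Bool} (hbad : ¬ (IsCodeword w ∧ ¬ IsOccurrence w q a) → r = false)
    (hlast : IsCodeword w ∧ ¬ IsOccurrence w q a → (∀ i, a i = w.length) → r = true)
    (hnext : IsCodeword w ∧ ¬ IsOccurrence w q a → (∃ i, a i ≠ w.length) →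
      ∀ v, ScanInv w (nextTuple w.length a) 0 true v →
        ∃ N ≤ K, HaltsIn ((automaton q).step w) N (true, v) r)
    {m p : ℕ} (hm : p + m = w.length) {ok : Bool} {v : Ctr q.length → ℕ}
    (h : ScanInv w a p ok v) :
    ∃ N ≤ K + m + 1, HaltsIn ((automaton q).step w) N (ok, v) r := by
  induction m generalizing p ok v with
  | zero =>
    obtain rfl : p = w.length := hm
    rcases step_end h ha with ⟨hs, hn⟩ | ⟨hy, ⟨hs, hn⟩ | ⟨hn, v', hs, h'⟩⟩
    · rw [hbad hn]
      exact ⟨1, by omega, .halt hs⟩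
    · rw [hlast hy hn]
      exact ⟨1, by omega, .halt hs⟩
    · obtain ⟨N, hN, hh⟩ := hnext hy hn v' h'
      exact ⟨N + 1, by omega, .step hs hh⟩
  | succ m ih =>
    rcases step_scan h (by omega) with ⟨hs, hn⟩ | ⟨ok', v', hs, h'⟩
    · rw [hbad fun h => hn h.1]
      exact ⟨1, by omega, .halt hs⟩
    · obtain ⟨N, hN, hh⟩ := ih (by omega) h'
      exact ⟨N + 1, by omega, .step hs hh⟩

/-- Here `d` is the number of tuples after `a`; each tuple costs at most one step per letter and one
at the end marker. -/
theorem haltsIn_from {w : List Letter} {d : ℕ} {a : Fin q.length → ℕ}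
    (hd : tupleValue w.length a + d + 1 = (w.length + 1) ^ q.length) (ha : ∀ i, a i ≤ w.length)
    {r : Bool} (hr : r = true ↔ IsCodeword w ∧ ∀ b : Fin q.length → ℕ, (∀ i, b i ≤ w.length) →
      tupleValue w.length a ≤ tupleValue w.length b → ¬ IsOccurrence w q b)
    {v : Ctr q.length → ℕ} (h : ScanInv w a 0 true v) :
    ∃ N ≤ (d + 1) * (w.length + 1), HaltsIn ((automaton q).step w) N (true, v) r := by
  induction d using Nat.strong_induction_on generalizing a v with
  | _ d ih =>
  have main := haltsIn_scan (K := d * (w.length + 1)) (r := r) ha ?_ ?_ ?_ (zero_add w.length) h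
  · obtain ⟨N, hN, hh⟩ := main
    exact ⟨N, hN.trans (by rw [Nat.succ_mul]; omega), hh⟩
  · intro hn
    rw [← Bool.not_eq_true, hr]
    exact fun h1 => hn ⟨h1.1, h1.2 a ha le_rfl⟩
  · intro hy hall
    rw [hr]
    refine ⟨hy.1, fun b hb hab => ?_⟩
    -- The tuple with all coordinates `n` has the largest value, so no other tuple remains.
    have := tupleValue_mono (n := w.length) (a := b) (b := a) fun i => by rw [hall]; exact hb i
    rw [← tupleValue_injOn ha hb (hab.antisymm this)]
    exact hy.2
  · intro hy hex v' h'
    have hval := tupleValue_nextTuple hex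
    have hlt := tupleValue_lt (nextTuple_le ha)
    obtain ⟨d, rfl⟩ : ∃ e, d = e + 1 := ⟨d - 1, by omega⟩
    refine ih d (by omega) (by omega) (nextTuple_le ha) ?_ h'
    rw [hr, hval]
    refine and_congr_right fun _ => forall₂_congr fun b hb => ?_
    refine ⟨fun h1 h2 => h1 (by omega), fun h1 h2 => ?_⟩
    rcases h2.lt_or_eq with h2 | h2
    · exact h1 h2
    · rw [← tupleValue_injOn ha hb h2]
      exact hy.2

theorem exists_haltsIn_automaton (q : List ℝ) (w : List Letter) :
    ∃ N r, HaltsIn ((automaton q).step w) N ((automaton q).start, fun _ => 0) r ∧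
      N ≤ (w.length + 1) ^ q.length * (w.length + 1) ∧ (r = true ↔ w ∈ avoidingCodewords q) := by
  classical
  have hpos : 0 < (w.length + 1) ^ q.length := by positivity
  have hr : w ∈ avoidingCodewords q ↔ IsCodeword w ∧ ∀ b : Fin q.length → ℕ,
      (∀ i, b i ≤ w.length) → tupleValue w.length (fun _ : Fin q.length => 0) ≤
        tupleValue w.length b → ¬ IsOccurrence w q b := by
    refine and_congr_right fun hw => ?_
    have hl : Legal w := hw.1
    rw [PatternPerm.Avoids, hl.contains_iff, not_exists]
    refine ⟨fun h b _ _ => h b, fun h b hb => h b (fun i => ?_) (by simp [tupleValue]) hb⟩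
    -- Positions of an occurrence carry letters and so lie below `|w|`: the bounded search misses
    -- none.
    obtain ⟨x, hx, -⟩ := hb.1 i
    exact (List.getElem?_eq_some_iff.1 hx).1.le
  obtain ⟨N, hN, h⟩ := haltsIn_from (d := (w.length + 1) ^ q.length - 1)
    (r := decide (w ∈ avoidingCodewords q)) (by simp [tupleValue]; omega) (fun _ => Nat.zero_le _)
    (decide_eq_true_iff.trans hr) (ScanInv.init w _ (fun _ => rfl) fun _ _ => rfl)
  exact ⟨N, _, h, by rwa [Nat.sub_add_cancel hpos] at hN, decide_eq_true_iff⟩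

instance : Finite Letter :=
  Finite.of_injective
    (fun x : Letter => match x with
      | .l => (0 : Fin 5) | .r => 1 | .m => 2 | .f => 3 | .t => 4)
    (by intro x y h; cases x <;> cases y <;> simp at h ⊢)

end ItEncoding

theorem mainTheorem1 (q : List ℝ) (hq : q.Nodup) :
    (∃ M : NTuring.Machine ItEncoding.Letter,
      M.IsLinearBounded ∧ M.RunsInPolynomialTime ∧
        M.language = ItEncoding.avoidingCodewords q) ∧
    IsContextSensitiveLanguage (ItEncoding.avoidingCodewords q) := by
  set D := (ItEncoding.automaton q).device with hD
  have hlang : D.machine.language = ItEncoding.avoidingCodewords q :=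
    SweepDevice.machine_language fun w => by
      obtain ⟨N, r, h, -, hr⟩ := ItEncoding.exists_haltsIn_automaton q w
      exact ⟨N, r, CounterAutomaton.haltsIn_device h, hr⟩
  refine ⟨⟨D.machine, D.machine_isLinearBounded, ?_, hlang⟩, ?_⟩
  · refine SweepDevice.machine_runsInPolynomialTime
      -- The number of tuples times the length of a scan bounds the number of sweeps.
      ((Polynomial.X + 1) ^ q.length * (Polynomial.X + 1)) fun w => ?_
    obtain ⟨N, r, h, hN, -⟩ := ItEncoding.exists_haltsIn_automaton q w
    exact ⟨N, r, CounterAutomaton.haltsIn_device h, by simpa using hN⟩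
  · rw [← hlang]
    refine D.machine_isLinearBounded.isContextSensitiveLanguage ?_
    rw [hlang]
    -- The empty word has no last letter `f`, so it is not a codeword.
    rintro ⟨⟨-, h, -⟩, -⟩
    simp at h
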